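/- **Conventions.** A *reduced crossed complex* $M$ is a chain complex of groups $\cdots\to M_n\xrightarrow{\delta_n}M_{n-1}\to\cdots\to M_1\xrightarrow{\delta_1}M_0$ with $M_n$ abelian for $n\ge2$, together with actions of $M_0$ by automorphisms on all $M_n$ ($n\ge1$) such that $\delta_1(M_1)$ acts trivially on $M_n$ for $n\ge2$, all $\delta_n$ preserve the actions ($M_0$ acts on itself by conjugation), and $\delta_1$ is a crossed module (the images of the $\delta_n$ are then automatically normal subgroups). Morphisms are chain maps preserving the actions; the category is $Crs(Grp)$. Let $Crs(Grp)_{i\ge}$ and $Crs(Grp)_{\ge i}$ be the full subcategories of complexes that are trivial above, respectively below, degree $i$. Let $\mathbf{cot}_i(M)=(M_i/\delta_{i+1}(M_{i+1})\to M_{i-1}\to\cdots\to M_0)$, let $Ker(\mathbf{cot}_i)$ be the full subcategory of the $M$ with $\mathbf{cot}_i(M)=0$, and let $\mathcal F_{\mathbf{tr}_i}$ be the full subcategory of the $M$ for which the canonical morphism $M\to\mathbf{cosk}_i\mathbf{tr}_i(M)=(\cdots\to0\to\ker\delta_i\to M_i\to\cdots\to M_0)$ is monic. On simplicial groups let $\mathcal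 M_{i\ge}$ and $\mathcal M_{\ge i}$ be the full subcategories of those whose Moore complex is trivial above, respectively below, degree $i$; let $Cot_i$ be the left adjoint of the inclusion of $\mathcal M_{i\ge}$, and let $\mathcal F_{tr_i}$ consist of the simplicial groups for which the unit of $tr_i\dashv cosk_i$ is monic. The members of $\mu(Grp)$ are the pairs $0=(0,Simp(Grp))$, $\mu_{\ge i+1}=(\mathcal M_{\ge i+1},\mathcal F_{tr_i})$ and $\mu_{i\ge}=(Ker(Cot_i),\mathcal M_{i\ge})$ for $i\ge0$, and $(Simp(Grp),0)$. A torsion theory in a pointed category is a pair $(\mathcal T,\mathcal F)$ of full replete subcategories such that every morphism from $\mathcal T$ to $\mathcal F$ is zero and every object $X$ has a short exact sequence $0\to T_X\to X\to F_X\to0$ with $T_X\in\mathcal T$ and $F_X\in\mathcal F$; $\mathcal T$ is its torsion category, and pairs are ordered by inclusion of their first components. **Theorem.** Let $n>1$. For $i\ge0$ consider the pairs of full subcategories of $Crs(Grp)_{n\ge}$ $$\mu'_{i\ge}=\bigl(Ker(\mathbf{cot}_i)\cap Crs(Grp)_{n\ge},\ Crs(Grp)_{i\ge}\cap Crs(Grp)_{n\ge}\bigr),$$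 $$\mu'_{\ge i+1}=\bigl(Crs(Grp)_{\ge i+1}\cap Crs(Grp)_{n\ge},\ \mathcal F_{\mathbf{tr}_i}\cap Crs(Grp)_{n\ge}\bigr),$$ together with the trivial pairs $0=(0,Crs(Grp)_{n\ge})$ and $Crs(Grp)_{n\ge}=(Crs(Grp)_{n\ge},0)$. Then: (a) These pairs are the restrictions of the corresponding members of $\mu(Grp)$ along the Moore normalization: if $M$ is in $Crs(Grp)_{n\ge}$ and $X$ is a simplicial group whose Moore complex is isomorphic to the complex underlying $M$ (in particular, if $X$ is the group $T$-complex corresponding to $M$), then $M$ belongs to the first (second) component of one of these pairs if and only if $X$ belongs to the first (second) component of the corresponding member of $\mu(Grp)$. (b) All these pairs are torsion theories in $Crs(Grp)_{n\ge}$. Up to equality they are exactly $0$, $\mu'_{\ge i+1}$ and $\mu'_{i\ge}$ for $0\le i<n$, and $Crs(Grp)_{n\ge}$, and they form the chain $$\mu(Crs(Grp)_{n\ge}):\quad 0\le\mu'_{\ge n}\le\mu'_{n-1\ge}\le\cdots\le\mu'_{\ge1}\le\mu'_{0\ge}\le Crs(Grp)_{n\ge}.$$ (c) The torsion category $Ker(\mathbf{cot}_{n-1})\cap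 Crs(Grp)_{n\ge}$ of $\mu'_{n-1\ge}$ is equivalent to the category of central extensions in abelian groups, that is, the category whose objects are the surjective homomorphisms of abelian groups and whose morphisms are the commutative squares. (d) The torsion category $Crs(Grp)_{\ge n}\cap Crs(Grp)_{n\ge}$ of $\mu'_{\ge n}$ is equivalent to the category of abelian groups. -/

import Mathlib

open CategoryTheory CategoryTheory.Limits
open Opposite

universe u

/-! ## Pairs of subcategories and torsion theories -/

/-- A pair `(T, F)` of full subcategories of a category. -/
@[ext] structure SubcatPair (C : Type*) [Category C] where
  T : ObjectProperty C
  F : ObjectProperty C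

namespace SubcatPair

variable {C : Type*} [Category C]

/-- The order by inclusion of the first components. -/
instance : LE (SubcatPair C) := ⟨fun p q => p.T ≤ q.T⟩

/-- The trivial pair `0 = (0, C)`. -/
def zero (C : Type*) [Category C] : SubcatPair C := ⟨fun X => IsZero X, ⊤⟩

/-- The trivial pair `(C, 0)`. -/
def all (C : Type*) [Category C] : SubcatPair C := ⟨⊤, fun X => IsZero X⟩

/-- The restriction `(T ∩ P, F ∩ P)` of a pair to a full subcategory `P`. -/
def restrict (p : SubcatPair C) (P : ObjectProperty C) : SubcatPair P.FullSubcategory :=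
  ⟨p.T.inverseImage P.ι, p.F.inverseImage P.ι⟩

/-- Torsion theories in a pointed category: both subcategories are replete, every morphism from
`T` to `F` is zero, and every object `X` sits in a short exact sequence `0 ⟶ A ⟶ X ⟶ B ⟶ 0`
(the first map is a kernel of the second one, which is a cokernel of the first one)
with `A` in `T` and `B` in `F`. -/
structure IsTorsionTheory [HasZeroMorphisms C] (p : SubcatPair C) : Prop where
  replete_T : p.T.IsClosedUnderIsomorphisms
  replete_F : p.F.IsClosedUnderIsomorphisms
  hom_eq_zero : ∀ ⦃A B : C⦄, p.T A → p.F B → ∀ f : A ⟶ B, f = 0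
  exists_ses : ∀ X : C, ∃ (A B : C) (ε : A ⟶ X) (η : X ⟶ B) (w : ε ≫ η = 0),
    p.T A ∧ p.F B ∧
      Nonempty (IsLimit (KernelFork.ofι ε w)) ∧ Nonempty (IsColimit (CokernelCofork.ofπ η w))

end SubcatPair

/-- The names of the members of the lattice `μ`: the two trivial torsion theories `0` and `all`,
the torsion theories `μ_{≥ i+1}` (`geSucc i`) and `μ_{i ≥}` (`le i`), for `i : ℕ`. -/
inductive MuIndex : Type
  | zero : MuIndex
  | geSucc (i : ℕ) : MuIndex
  | le (i : ℕ) : MuIndex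
  | all : MuIndex

/-! ## Simplicial groups, the Moore complex and the lattice `μ(Grp)` -/

/-- The category of simplicial groups. -/
abbrev SimpGrp : Type (u + 1) := SimplicialObject GrpCat.{u}

namespace SimpGrp

/-- The Moore complex: `N(X)_0 = X_0` and `N(X)_n = ⋂_{i < n} ker (d_i : X_n ⟶ X_{n-1})`. -/
def moore (X : SimpGrp.{u}) : ∀ n : ℕ, Subgroup (X.obj (op (SimplexCategory.mk n)))
  | 0 => ⊤
  | n + 1 => ⨅ i : Fin (n + 1), (X.δ i.castSucc).hom.ker

theorem δ_last_mem (X : SimpGrp.{u}) (n : ℕ) (x : X.obj (op (SimplexCategory.mk (n + 1)))) (hx : x ∈ moore X (n + 1)) :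
    (X.δ (Fin.last (n + 1))).hom x ∈ moore X n := by
  cases n with
  | zero => exact Subgroup.mem_top _
  | succ n =>
    simp only [moore, Subgroup.mem_iInf, MonoidHom.mem_ker] at hx ⊢
    intro i
    have h := X.δ_comp_δ (i := i.castSucc) (j := Fin.last (n + 1)) (Fin.le_last _)
    have h1 := congrArg (fun f => f.hom x) h
    simp only [GrpCat.hom_comp, MonoidHom.comp_apply] at h1
    rw [Fin.succ_last] at h1
    rw [h1, hx i.castSucc, map_one]

/-- The differential `N(X)_{n+1} ⟶ N(X)_n` of the Moore complex, induced by `d_{n+1}`. -/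
def mooreD (X : SimpGrp.{u}) (n : ℕ) : moore X (n + 1) →* moore X n :=
  ((X.δ (Fin.last (n + 1))).hom.comp (moore X (n + 1)).subtype).codRestrict (moore X n)
    (fun x => δ_last_mem X n x.1 x.2)

/-- `M_{n ≥}`: the simplicial groups whose Moore complex is trivial above degree `n`. -/
def mLE (n : ℕ) : ObjectProperty SimpGrp.{u} := fun X => ∀ i, n < i → moore X i = ⊥

/-- `M_{≥ n}`: the simplicial groups whose Moore complex is trivial below degree `n`. -/
def mGE (n : ℕ) : ObjectProperty SimpGrp.{u} := fun X => ∀ i, i < n → moore X i = ⊥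

/-- `Ker (Cot_n)`, where `Cot_n` is the left adjoint of the inclusion of `M_{n ≥}`:
the simplicial groups whose universal arrow to `M_{n ≥}` has a zero object as its target. -/
def kerCot (n : ℕ) : ObjectProperty SimpGrp.{u} := fun X =>
  ∃ (Y : SimpGrp.{u}) (η : X ⟶ Y), mLE n Y ∧ IsZero Y ∧
    ∀ Z : SimpGrp.{u}, mLE n Z → Function.Bijective (fun g : Y ⟶ Z => η ≫ g)

/-- `F_{tr_n}`: the simplicial groups for which the unit of `tr_n ⊣ cosk_n` is monic. -/
def fTr (n : ℕ) : ObjectProperty SimpGrp.{u} := fun X =>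
  Mono ((SimplicialObject.coskAdj (C := GrpCat.{u}) n).unit.app X)

/-- The lattice `μ(Grp)` in simplicial groups. -/
def mu : MuIndex → SubcatPair SimpGrp.{u}
  | .zero => SubcatPair.zero _
  | .geSucc i => ⟨mGE (i + 1), fTr i⟩
  | .le i => ⟨kerCot i, mLE i⟩
  | .all => SubcatPair.all _

end SimpGrp

/-! ## Reduced crossed complexes -/

/-- Reduced crossed complexes (crossed complexes in groups). The group `X 0` acts on all `X i`
by automorphisms; on `X 0` itself the action is conjugation, so that `d_act` for `i = 0`
is the first axiom of a crossed module for `d 0 : X 1 → X 0`. Here `d i` is the differential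
`δ_{i+1} : M_{i+1} → M_i`. The images of the differentials are automatically normal,
see `CrsGrp.range_normal`. -/
structure CrsGrp : Type (u + 1) where
  X : ℕ → Type u
  [grp : ∀ i, Group (X i)]
  d : ∀ i, X (i + 1) →* X i
  d_d : ∀ i x, d i (d (i + 1) x) = 1
  act : ∀ i, X 0 → X i → X i
  act_zero : ∀ g x, act 0 g x = g * x * g⁻¹
  one_act : ∀ i x, act i 1 x = x
  mul_act : ∀ i g h x, act i (g * h) x = act i g (act i h x)
  act_mul : ∀ i g x y, act i g (x * y) = act i g x * act i g y
  d_act : ∀ i g x, d i (act (i + 1) g x) = act i g (d i x)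
  peiffer : ∀ x y : X 1, act 1 (d 0 x) y = x * y * x⁻¹
  comm : ∀ i (x y : X (i + 2)), x * y = y * x
  act_d : ∀ i (x : X 1) (y : X (i + 2)), act (i + 2) (d 0 x) y = y

attribute [instance] CrsGrp.grp

namespace CrsGrp

/-- A reduced crossed complex is a proper chain complex. -/
theorem range_normal (M : CrsGrp.{u}) (i : ℕ) : (M.d i).range.Normal := by
  constructor
  rintro _ ⟨x, rfl⟩ g
  match i, x, g with
  | 0, x, g => exact ⟨M.act 1 g x, by rw [M.d_act, M.act_zero]⟩
  | 1, x, g => exact ⟨M.act 2 (M.d 0 g) x, by rw [M.d_act, M.peiffer]⟩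
  | i + 2, x, g => exact ⟨x, by rw [M.comm i g, mul_inv_cancel_right]⟩

theorem act_one (M : CrsGrp.{u}) (i : ℕ) (g : M.X 0) : M.act i g 1 = 1 := by
  have h := M.act_mul i g 1 1
  rw [mul_one] at h
  exact left_eq_mul.mp h

/-- Morphisms: chain maps that preserve all actions. -/
@[ext] structure Hom (M N : CrsGrp.{u}) : Type u where
  f : ∀ i, M.X i →* N.X i
  comm_d : ∀ i x, f i (M.d i x) = N.d i (f (i + 1) x)
  map_act : ∀ i g x, f i (M.act i g x) = N.act i (f 0 g) (f i x)

/-- The category `Crs(Grp)` of reduced crossed complexes. -/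
instance : Category CrsGrp.{u} where
  Hom := Hom
  id M := ⟨fun _ => MonoidHom.id _, fun _ _ => rfl, fun _ _ _ => rfl⟩
  comp φ ψ := ⟨fun i => (ψ.f i).comp (φ.f i),
    fun i x => by simp [φ.comm_d, ψ.comm_d], fun i g x => by simp [φ.map_act, ψ.map_act]⟩

instance : HasZeroMorphisms CrsGrp.{u} where
  zero M N := ⟨⟨fun _ => 1, fun _ _ => by simp, fun i _ _ => by simp [N.act_one]⟩⟩
  comp_zero _ _ := rfl
  zero_comp _ _ _ φ := Hom.ext (funext fun i => MonoidHom.ext fun _ => map_one (Hom.f φ i))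

/-! ### Quotients -/

/-- A normal subcomplex: what is needed for the degreewise quotient to be a crossed complex. -/
structure NormalSub (M : CrsGrp.{u}) where
  K : ∀ i, Subgroup (M.X i)
  normal : ∀ i, (K i).Normal
  d_mem : ∀ i x, x ∈ K (i + 1) → M.d i x ∈ K i
  act_mem : ∀ i g x, x ∈ K i → M.act i g x ∈ K i
  act_div_mem : ∀ i g x, g ∈ K 0 → M.act i g x * x⁻¹ ∈ K i

attribute [instance] NormalSub.normal

theorem NormalSub.act_rel {M : CrsGrp.{u}} (S : NormalSub M) (i : ℕ) {g h : M.X 0} {x y : M.X i}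
    (hgh : (g : M.X 0 ⧸ S.K 0) = h) (hxy : (x : M.X i ⧸ S.K i) = y) :
    ((M.act i g x : M.X i) : M.X i ⧸ S.K i) = (M.act i h y : M.X i) := by
  have e1 : M.act i g x = M.act i h (M.act i (h⁻¹ * g) x) := by
    rw [← M.mul_act, mul_inv_cancel_left]
  have e2 : ((M.act i (h⁻¹ * g) x : M.X i) : M.X i ⧸ S.K i) = x := by
    rw [← div_eq_one, ← QuotientGroup.mk_div, QuotientGroup.eq_one_iff, div_eq_mul_inv]
    exact S.act_div_mem i _ _ (QuotientGroup.eq.mp hgh.symm)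
  rw [e1]
  have e3 := QuotientGroup.eq.mp (e2.trans hxy).symm
  refine (QuotientGroup.eq.mpr ?_).symm
  have e4 := S.act_mem i h _ e3
  rw [M.act_mul] at e4
  have e5 : M.act i h y⁻¹ = (M.act i h y)⁻¹ := by
    rw [eq_inv_iff_mul_eq_one, ← M.act_mul, inv_mul_cancel, M.act_one]
  rwa [e5] at e4

/-- The quotient crossed complex `M/K`. -/
def quot (M : CrsGrp.{u}) (S : NormalSub M) : CrsGrp.{u} where
  X i := M.X i ⧸ S.K i
  d i := QuotientGroup.map _ _ (M.d i) (fun x hx => S.d_mem i x hx)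
  d_d i x := by
    induction x using QuotientGroup.induction_on with
    | H x => exact congrArg (QuotientGroup.mk (s := S.K i)) (M.d_d i x)
  act i := Quotient.map₂ (M.act i) (fun _ _ hg _ _ hx =>
    Quotient.exact (S.act_rel i (Quotient.sound hg) (Quotient.sound hx)))
  act_zero g x := by
    induction g using QuotientGroup.induction_on with
    | H g =>
    induction x using QuotientGroup.induction_on with
    | H x => exact congrArg (QuotientGroup.mk (s := S.K 0)) (M.act_zero g x)
  one_act i x := by
    induction x using QuotientGroup.induction_on with
    | H x => exact congrArg (QuotientGroup.mk (s := S.K i)) (M.one_act i x)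
  mul_act i g h x := by
    induction g using QuotientGroup.induction_on with
    | H g =>
    induction h using QuotientGroup.induction_on with
    | H h =>
    induction x using QuotientGroup.induction_on with
    | H x => exact congrArg (QuotientGroup.mk (s := S.K i)) (M.mul_act i g h x)
  act_mul i g x y := by
    induction g using QuotientGroup.induction_on with
    | H g =>
    induction x using QuotientGroup.induction_on with
    | H x =>
    induction y using QuotientGroup.induction_on with
    | H y => exact congrArg (QuotientGroup.mk (s := S.K i)) (M.act_mul i g x y)
  d_act i g x := by
    induction g using QuotientGroup.induction_on with
    | H g =>
    induction x using QuotientGroup.induction_on with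
    | H x => exact congrArg (QuotientGroup.mk (s := S.K i)) (M.d_act i g x)
  peiffer x y := by
    induction x using QuotientGroup.induction_on with
    | H x =>
    induction y using QuotientGroup.induction_on with
    | H y => exact congrArg (QuotientGroup.mk (s := S.K 1)) (M.peiffer x y)
  comm i x y := by
    induction x using QuotientGroup.induction_on with
    | H x =>
    induction y using QuotientGroup.induction_on with
    | H y => exact congrArg (QuotientGroup.mk (s := S.K (i + 2))) (M.comm i x y)
  act_d i x y := by
    induction x using QuotientGroup.induction_on with
    | H x =>
    induction y using QuotientGroup.induction_on with
    | H y => exact congrArg (QuotientGroup.mk (s := S.K (i + 2))) (M.act_d i x y)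

/-! ### Truncation conditions and cotruncation -/

/-- `Crs(Grp)_{n ≥}`: the reduced crossed complexes with `M_i = 0` for `i > n`,
that is, the `n`-truncated ones. -/
def crsLE (n : ℕ) : ObjectProperty CrsGrp.{u} := fun M => ∀ i, n < i → Subsingleton (M.X i)

/-- `Crs(Grp)_{≥ n}`: the reduced crossed complexes with `M_i = 0` for `i < n`. -/
def crsGE (n : ℕ) : ObjectProperty CrsGrp.{u} := fun M => ∀ i, i < n → Subsingleton (M.X i)

/-- The subcomplex that is `0` below degree `n`, the image of `δ_{n+1}` in degree `n`, and
everything above degree `n`. -/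
def cotSub (n : ℕ) (M : CrsGrp.{u}) : NormalSub M where
  K i := if i < n then ⊥ else if i = n then (M.d i).range else ⊤
  normal i := by
    split_ifs
    · infer_instance
    · exact M.range_normal i
    · infer_instance
  d_mem i x hx := by
    split_ifs at hx ⊢ <;> first | omega | skip
    · rw [Subgroup.mem_bot.mp hx, map_one]; exact Subgroup.mem_bot.mpr rfl
    · obtain ⟨y, rfl⟩ := hx; exact Subgroup.mem_bot.mpr (M.d_d i y)
    · exact ⟨x, rfl⟩
    · exact Subgroup.mem_top _
  act_mem i g x hx := by
    split_ifs at hx ⊢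
    · rw [Subgroup.mem_bot.mp hx, M.act_one]; exact Subgroup.mem_bot.mpr rfl
    · obtain ⟨y, rfl⟩ := hx; exact ⟨M.act (i + 1) g y, M.d_act i g y⟩
    · exact Subgroup.mem_top _
  act_div_mem i g x hg := by
    by_cases h0 : 0 < n
    · rw [if_pos h0, Subgroup.mem_bot] at hg
      rw [hg, M.one_act, mul_inv_cancel]
      exact Subgroup.one_mem _
    · obtain rfl : n = 0 := by omega
      simp only [lt_irrefl, if_false, if_true] at hg
      obtain ⟨y, rfl⟩ := hg
      split_ifs with h1 h2
      · omega
      · subst h2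
        rw [M.act_zero, mul_assoc, mul_assoc, ← mul_assoc x]
        exact Subgroup.mul_mem _ ⟨y, rfl⟩
          ((M.range_normal 0).conj_mem _ (Subgroup.inv_mem _ ⟨y, rfl⟩) x)
      · exact Subgroup.mem_top _

/-- The cotruncation `cot_n : Crs(Grp) ⥤ Crs(Grp)_{n ≥}`,
`cot_n(M) = (M_n / δ_{n+1}(M_{n+1}) → M_{n-1} → ⋯ → M_0)`. -/
def cot (n : ℕ) : CrsGrp.{u} ⥤ (crsLE.{u} n).FullSubcategory where
  obj M := ⟨M.quot (cotSub n M), fun i hi => by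
    have h : (cotSub n M).K i = ⊤ := by
      simp only [cotSub]; rw [if_neg (by omega), if_neg (by omega)]
    change Subsingleton (M.X i ⧸ (cotSub n M).K i)
    rw [h]; exact QuotientGroup.subsingleton_quotient_top⟩
  map {M N} φ := ObjectProperty.homMk
    { f := fun i => QuotientGroup.map _ _ (Hom.f φ i) (fun x hx => by
        simp only [cotSub, Subgroup.mem_comap] at hx ⊢
        split_ifs at hx ⊢
        · rw [Subgroup.mem_bot.mp hx, map_one]; exact Subgroup.mem_bot.mpr rfl
        · obtain ⟨y, rfl⟩ := hx; exact ⟨Hom.f φ (i + 1) y, (Hom.comm_d φ i y).symm⟩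
        · exact Subgroup.mem_top _)
      comm_d := fun i x => by
        induction x using QuotientGroup.induction_on with
        | H x => exact congrArg (QuotientGroup.mk (s := (cotSub n N).K i)) (Hom.comm_d φ i x)
      map_act := fun i g x => by
        induction g using QuotientGroup.induction_on with
        | H g =>
        induction x using QuotientGroup.induction_on with
        | H x => exact congrArg (QuotientGroup.mk (s := (cotSub n N).K i)) (Hom.map_act φ i g x) }
  map_id M := by
    apply ObjectProperty.hom_ext
    refine Hom.ext (funext fun i => MonoidHom.ext fun x => ?_)
    induction x using QuotientGroup.induction_on with
    | H x => rfl
  map_comp φ ψ := by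
    apply ObjectProperty.hom_ext
    refine Hom.ext (funext fun i => MonoidHom.ext fun x => ?_)
    induction x using QuotientGroup.induction_on with
    | H x => rfl

/-- `Ker (cot_n)`: the reduced crossed complexes `M` with `cot_n(M) = 0`. -/
def kerCot (n : ℕ) : ObjectProperty CrsGrp.{u} := fun M => IsZero ((cot n).obj M)

/-! ### Coskeleta -/

/-- The kernel of `δ_n : M_n → M_{n-1}`, which is all of `M_0` for `n = 0`. -/
def cycles (M : CrsGrp.{u}) : ∀ n, Subgroup (M.X n)
  | 0 => ⊤
  | n + 1 => (M.d n).ker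

theorem act_mem_cycles (M : CrsGrp.{u}) (n : ℕ) (g : M.X 0) (x : M.X n) (hx : x ∈ M.cycles n) :
    M.act n g x ∈ M.cycles n := by
  cases n with
  | zero => exact Subgroup.mem_top _
  | succ n =>
    change M.d n _ = 1
    rw [M.d_act, show M.d n x = 1 from hx, M.act_one]

theorem d_mem_cycles (M : CrsGrp.{u}) (n : ℕ) (x : M.X (n + 1)) : M.d n x ∈ M.cycles n := by
  cases n with
  | zero => exact Subgroup.mem_top _
  | succ n => exact M.d_d n x

theorem cycles_comm (M : CrsGrp.{u}) (i : ℕ) (x y : M.X (i + 1)) (hx : x ∈ M.cycles (i + 1)) :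
    x * y = y * x := by
  match i, x, y, hx with
  | 0, x, y, hx =>
    have h := M.peiffer x y
    rw [show M.d 0 x = 1 from hx, M.one_act, eq_mul_inv_iff_mul_eq] at h
    exact h.symm
  | i + 1, x, y, _ => exact M.comm i _ _

/-- The group of `cosk_n(tr_n(M))` in degree `i + 1`, as a group of pairs `(x, z)` with
`x ∈ M_{i+1}` and `z ∈ ker δ_i ⊆ M_i`. It consists of the pairs `(x, δ_{i+1}(x))` if `i + 1 ≤ n`
(a copy of `M_{i+1}`), of the pairs `(1, z)` if `i = n` (a copy of `ker δ_n`), and it is trivial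
if `i > n`. -/
def coskSub (n : ℕ) (M : CrsGrp.{u}) (i : ℕ) : Subgroup (M.X (i + 1) × M.X i) where
  carrier := {p | p.2 ∈ M.cycles i ∧ (i < n → p.2 = M.d i p.1) ∧ (n ≤ i → p.1 = 1) ∧
    (n < i → p.2 = 1)}
  one_mem' := by simp
  mul_mem' {p q} hp hq := by
    obtain ⟨p1, p2, p3, p4⟩ := hp
    obtain ⟨q1, q2, q3, q4⟩ := hq
    refine ⟨Subgroup.mul_mem _ p1 q1, fun h => ?_, fun h => ?_, fun h => ?_⟩
    · simp [p2 h, q2 h]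
    · simp [p3 h, q3 h]
    · simp [p4 h, q4 h]
  inv_mem' {p} hp := by
    obtain ⟨p1, p2, p3, p4⟩ := hp
    refine ⟨Subgroup.inv_mem _ p1, fun h => ?_, fun h => ?_, fun h => ?_⟩
    · simp [p2 h]
    · simp [p3 h]
    · simp [p4 h]

/-- The groups of `cosk_n(tr_n(M))`. -/
def coskX (n : ℕ) (M : CrsGrp.{u}) : ℕ → Type u
  | 0 => M.X 0
  | i + 1 => coskSub n M i

instance coskGroup (n : ℕ) (M : CrsGrp.{u}) : ∀ i, Group (coskX n M i)
  | 0 => M.grp 0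
  | i + 1 => inferInstanceAs (Group (coskSub n M i))

/-- The differentials of `cosk_n(tr_n(M))`: `(x, z)` is sent to `z` in degree `0`, and to `(z, 1)`
in higher degrees, where `1 = δ(z)`. -/
def coskD (n : ℕ) (M : CrsGrp.{u}) : ∀ i, coskX n M (i + 1) →* coskX n M i
  | 0 => (MonoidHom.snd (M.X 1) (M.X 0)).comp (coskSub n M 0).subtype
  | i + 1 => ((MonoidHom.prod (MonoidHom.snd (M.X (i + 2)) (M.X (i + 1))) 1).comp
      (coskSub n M (i + 1)).subtype).codRestrict (coskSub n M i) (fun p => by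
        obtain ⟨p, p1, p2, p3, p4⟩ := p
        exact ⟨Subgroup.one_mem _, fun _ => Eq.symm p1, fun h => p4 (by omega), fun _ => rfl⟩)

/-- The action of `M_0` on `cosk_n(tr_n(M))`. -/
def coskAct (n : ℕ) (M : CrsGrp.{u}) : ∀ i, M.X 0 → coskX n M i → coskX n M i
  | 0 => M.act 0
  | i + 1 => fun g p => (⟨(M.act (i + 1) g p.1.1, M.act i g p.1.2), by
      obtain ⟨p, p1, p2, p3, p4⟩ := p
      refine ⟨M.act_mem_cycles i g _ p1, fun h => ?_, fun h => ?_, fun h => ?_⟩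
      · change M.act i g p.2 = M.d i (M.act (i + 1) g p.1)
        rw [p2 h, M.d_act]
      · change M.act (i + 1) g p.1 = 1
        rw [p3 h, M.act_one]
      · change M.act i g p.2 = 1
        rw [p4 h, M.act_one]⟩ : coskSub n M i)

theorem coskX_ext {n : ℕ} {M : CrsGrp.{u}} {i : ℕ} {p q : coskSub n M i}
    (h1 : p.1.1 = q.1.1) (h2 : p.1.2 = q.1.2) : p = q :=
  Subtype.ext (Prod.ext h1 h2)

/-- The coskeleton `cosk_n(tr_n(M)) = (⋯ → 0 → ker δ_n → M_n → M_{n-1} → ⋯ → M_0)`. -/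
def coskTr (n : ℕ) (M : CrsGrp.{u}) : CrsGrp.{u} where
  X := coskX n M
  d := coskD n M
  d_d i x := by
    cases i with
    | zero => rfl
    | succ i => exact coskX_ext rfl rfl
  act := coskAct n M
  act_zero g x := M.act_zero g x
  one_act i x := by
    cases i with
    | zero => exact M.one_act 0 x
    | succ i => exact coskX_ext (M.one_act _ _) (M.one_act _ _)
  mul_act i g h x := by
    cases i with
    | zero => exact M.mul_act 0 g h x
    | succ i => exact coskX_ext (M.mul_act _ g h _) (M.mul_act _ g h _)
  act_mul i g x y := by
    cases i with
    | zero => exact M.act_mul 0 g x y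
    | succ i => exact coskX_ext (M.act_mul _ g _ _) (M.act_mul _ g _ _)
  d_act i g x := by
    cases i with
    | zero => rfl
    | succ i => exact coskX_ext rfl (M.act_one _ _).symm
  peiffer x y := by
    obtain ⟨⟨x, x'⟩, _, x2, x3, _⟩ := x
    obtain ⟨⟨y, y'⟩, _, y2, y3, _⟩ := y
    refine coskX_ext ?_ (M.act_zero x' y')
    change M.act 1 x' y = x * y * x⁻¹
    by_cases h : 0 < n
    · rw [← M.peiffer, show x' = M.d 0 x from x2 h]
    · rw [show x = 1 from x3 (by omega), show y = 1 from y3 (by omega), M.act_one]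
      simp
  comm i x y := coskX_ext (M.comm i _ _) (M.cycles_comm i _ _ x.2.1)
  act_d i x y := by
    obtain ⟨⟨x, x'⟩, _, x2, _, _⟩ := x
    obtain ⟨⟨y, y'⟩, y1, _, y3, y4⟩ := y
    change y' ∈ M.cycles (i + 1) at y1
    by_cases h : 0 < n
    · obtain rfl : x' = M.d 0 x := x2 h
      refine coskX_ext (M.act_d i x y) ?_
      change M.act (i + 1) (M.d 0 x) y' = y'
      match i, y', y1 with
      | 0, y', y1 => rw [M.peiffer, ← M.cycles_comm 0 y' x y1, mul_inv_cancel_right]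
      | i + 1, y', _ => exact M.act_d i x y'
    · obtain rfl : y = 1 := y3 (by omega)
      obtain rfl : y' = 1 := y4 (by omega)
      exact coskX_ext (M.act_one _ _) (M.act_one _ _)

/-- The unit `M ⟶ cosk_n(tr_n(M))`: the identity in degrees `≤ n`, induced by `δ_{n+1}` in degree
`n + 1`, and trivial above. -/
def coskUnit (n : ℕ) (M : CrsGrp.{u}) : M ⟶ coskTr n M where
  f
    | 0 => MonoidHom.id _
    | i + 1 => (MonoidHom.prod (if i < n then MonoidHom.id (M.X (i + 1)) else 1)
        (if i ≤ n then M.d i else 1)).codRestrict (coskSub n M i) (fun x => by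
          refine ⟨?_, fun h => ?_, fun h => ?_, fun h => ?_⟩
          · change (if i ≤ n then M.d i else 1) x ∈ M.cycles i
            split_ifs
            · exact M.d_mem_cycles i x
            · exact Subgroup.one_mem _
          · simp [h, h.le]
          · simp [not_lt.mpr h]
          · simp [not_le.mpr h])
  comm_d i x := by
    cases i with
    | zero =>
      change M.d 0 x = (if 0 ≤ n then M.d 0 else 1) x
      simp
    | succ i =>
      refine coskX_ext ?_ ?_
      · change (if i < n then MonoidHom.id (M.X (i + 1)) else 1) (M.d (i + 1) x) =
          (if i + 1 ≤ n then M.d (i + 1) else 1) x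
        by_cases h : i < n
        · simp [h]
        · simp [h]
      · change (if i ≤ n then M.d i else 1) (M.d (i + 1) x) = 1
        split_ifs
        · exact M.d_d i x
        · rfl
  map_act i g x := by
    cases i with
    | zero => rfl
    | succ i =>
      refine coskX_ext ?_ ?_
      · change (if i < n then MonoidHom.id (M.X (i + 1)) else 1) (M.act (i + 1) g x) =
          M.act (i + 1) g ((if i < n then MonoidHom.id (M.X (i + 1)) else 1) x)
        split_ifs
        · rfl
        · exact (M.act_one _ _).symm
      · change (if i ≤ n then M.d i else 1) (M.act (i + 1) g x) =
          M.act i g ((if i ≤ n then M.d i else 1) x)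
        split_ifs
        · exact M.d_act i g x
        · exact (M.act_one _ _).symm

/-- `F_{tr_n}`: the reduced crossed complexes for which the unit of `tr_n ⊣ cosk_n` is monic. -/
def fTr (n : ℕ) : ObjectProperty CrsGrp.{u} := fun M => Mono (coskUnit n M)

/-! ### The lattice on crossed complexes -/

/-- The lattice `μ(Crs(Grp))`, given by the functors `cot_n`, `tr_n` and `cosk_n`:
`μ_{≥ i+1} = (Crs(Grp)_{≥ i+1}, F_{tr_i})` and `μ_{i ≥} = (Ker (cot_i), Crs(Grp)_{i ≥})`. -/
def mu : MuIndex → SubcatPair CrsGrp.{u}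
  | .zero => SubcatPair.zero _
  | .geSucc i => ⟨crsGE (i + 1), fTr i⟩
  | .le i => ⟨kerCot i, crsLE i⟩
  | .all => SubcatPair.all _

/-- The restriction of the lattice to `Crs(Grp)_{n ≥}`. -/
def muLE (n : ℕ) (k : MuIndex) : SubcatPair (crsLE.{u} n).FullSubcategory :=
  (mu k).restrict (crsLE n)

/-- The Moore complex of the simplicial group `X` is isomorphic to the complex
underlying `M`. -/
def IsMooreComplexOf (M : CrsGrp.{u}) (X : SimpGrp.{u}) : Prop :=
  ∃ φ : ∀ i, SimpGrp.moore X i ≃* M.X i,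
    ∀ i x, φ i (SimpGrp.mooreD X i x) = M.d i (φ (i + 1) x)

end CrsGrp

/-- The surjective homomorphisms of abelian groups, that is, the central extensions in abelian
groups; morphisms between them are the commutative squares. -/
def surjAb : ObjectProperty (Arrow CommGrpCat.{u}) := fun p => Function.Surjective p.hom.hom

/-! ### Simplicial identities on elements, and morphisms on Moore complexes. -/

namespace SimpGrp

/-! Every class in the two lattices can be read off from a chain complex: the Moore complex of a
simplicial group, or the complex underlying a crossed complex. Monicity of the unit of `tr_i ⊣
cosk_i` means that the differential out of degree `i + 1` is injective and everything above degree
`i + 1` vanishes. Vanishing of the cotruncation means that everything below degree `i` vanishes and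
the differential into degree `i` is onto. These criteria are `fTr_iff` and `kerCot_iff`, proved in
both settings; the remaining classes are given by vanishing of degrees. Hence (a) is transport along
an isomorphism of complexes.

On the simplicial side the engine is that the Moore complex generates a simplicial group under
degeneracies (`eq_top_of_moore_le`), so morphisms are determined on it (`hom_ext_of_moore`). The
criteria follow by testing against the largest simplicial subgroup that is trivial up to dimension
`i`, and against the quotient by `cotSub`.

For (b), the normal subcomplexes `trSub` and `cotSub` are the torsion parts, and kernels and
cokernels are degreewise. Vanishing of morphisms and the chain of inclusions follow from the
criteria. When `i ≥ n`, both pairs collapse to `0`.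

For (c) and (d), the torsion objects live in degrees `n - 1` and `n` only. Since `n > 1`, degree `0`
is trivial, so the actions are trivial and both groups are abelian: what remains is one homomorphism
of abelian groups, surjective in (c) and with trivial target in (d). -/

theorem δ_δ_apply (X : SimpGrp.{u}) {n : ℕ} {i j : Fin (n + 2)} (h : i ≤ j)
    (x : X.obj (op (SimplexCategory.mk (n + 2)))) :
    (X.δ i).hom ((X.δ j.succ).hom x) = (X.δ j).hom ((X.δ i.castSucc).hom x) :=
  congrArg (fun f => f.hom x) (X.δ_comp_δ h)

theorem δ_σ_self_apply (X : SimpGrp.{u}) {n : ℕ} (i : Fin (n + 1))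
    (x : X.obj (op (SimplexCategory.mk n))) :
    (X.δ i.castSucc).hom ((X.σ i).hom x) = x :=
  congrArg (fun f => f.hom x) (X.δ_comp_σ_self (i := i))

theorem δ_σ_apply_of_le (X : SimpGrp.{u}) {n : ℕ} {i : Fin (n + 2)} {j : Fin (n + 1)}
    (h : i ≤ j.castSucc) (x : X.obj (op (SimplexCategory.mk (n + 1)))) :
    (X.δ i.castSucc).hom ((X.σ j.succ).hom x) = (X.σ j).hom ((X.δ i).hom x) :=
  congrArg (fun f => f.hom x) (X.δ_comp_σ_of_le h)

theorem map_comp_apply (X : SimpGrp.{u}) {a b c : SimplexCategory} (f : a ⟶ b) (g : b ⟶ c)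
    (x : X.obj (op c)) :
    (X.map (f ≫ g).op).hom x = (X.map f.op).hom ((X.map g.op).hom x) := by
  rw [op_comp, X.map_comp]; rfl

theorem naturality_apply {X Y : SimpGrp.{u}} (f : X ⟶ Y) {a b : SimplexCategory} (g : a ⟶ b)
    (x : X.obj (op b)) :
    (f.app (op a)).hom ((X.map g.op).hom x) = (Y.map g.op).hom ((f.app (op b)).hom x) :=
  congrArg (fun h => h.hom x) (f.naturality g.op)

theorem mem_moore_succ {X : SimpGrp.{u}} {n : ℕ} {x : X.obj (op (SimplexCategory.mk (n + 1)))} :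
    x ∈ moore X (n + 1) ↔ ∀ i : Fin (n + 1), (X.δ i.castSucc).hom x = 1 := by
  simp [moore, Subgroup.mem_iInf, MonoidHom.mem_ker]

theorem map_mem_moore {X Y : SimpGrp.{u}} (f : X ⟶ Y) {n : ℕ}
    {x : X.obj (op (SimplexCategory.mk n))} (hx : x ∈ moore X n) :
    (f.app (op (SimplexCategory.mk n))).hom x ∈ moore Y n := by
  cases n with
  | zero => exact Subgroup.mem_top _
  | succ n =>
    rw [mem_moore_succ] at hx ⊢
    intro i
    rw [SimplicialObject.δ_def, ← naturality_apply, ← SimplicialObject.δ_def, hx i, map_one]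

/-! ### Normalization of simplices -/

/-- Multiplying by the inverse of a degeneracy makes the `k`-th face of `x` trivial. -/
def killFace (X : SimpGrp.{u}) {n : ℕ} (k : Fin (n + 1))
    (x : X.obj (op (SimplexCategory.mk (n + 1)))) : X.obj (op (SimplexCategory.mk (n + 1))) :=
  x * ((X.σ k).hom ((X.δ k.castSucc).hom x))⁻¹

/-- The `k`-th face dies by `d_k s_k = 1`. For `i < k`, `d_i s_k d_k = s_{k-1} d_{k-1} d_i`, so
faces already trivial stay trivial. Faces can thus be killed one after another in increasing order.
-/
theorem δ_killFace (X : SimpGrp.{u}) {n : ℕ} (k : Fin (n + 1))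
    (x : X.obj (op (SimplexCategory.mk (n + 1))))
    (hx : ∀ i : Fin (n + 1), i < k → (X.δ i.castSucc).hom x = 1)
    (i : Fin (n + 1)) (hi : i ≤ k) : (X.δ i.castSucc).hom (killFace X k x) = 1 := by
  rw [killFace, map_mul, map_inv]
  rcases hi.lt_or_eq with hi | rfl
  · rw [hx i hi, one_mul, inv_eq_one]
    obtain ⟨n, rfl⟩ : ∃ m, n = m + 1 := ⟨n - 1, by have := i.2; have := k.2; omega⟩
    obtain ⟨k, rfl⟩ := Fin.exists_succ_eq_of_ne_zero (Fin.ne_zero_of_lt hi)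
    have hik : i ≤ k.castSucc := by
      rw [Fin.lt_def] at hi; rw [Fin.le_def]; simp at hi ⊢; omega
    rw [δ_σ_apply_of_le X hik, ← Fin.succ_castSucc, δ_δ_apply X hik, hx i hi, map_one, map_one]
  · rw [δ_σ_self_apply, mul_inv_cancel]

/-- A family of subgroups that contains the Moore complex and all degeneracies is everything. -/
theorem eq_top_of_moore_le (X : SimpGrp.{u})
    (H : ∀ n, Subgroup (X.obj (op (SimplexCategory.mk n))))
    (hN : ∀ n, moore X n ≤ H n)
    (hσ : ∀ n (k : Fin (n + 1)) x, x ∈ H n → (X.σ k).hom x ∈ H (n + 1)) (n : ℕ) : H n = ⊤ := by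
  induction n with
  | zero => exact top_le_iff.mp (hN 0)
  | succ n ih =>
    -- Here `m` counts the faces not yet known to be trivial. Each step splits off a degeneracy of
    -- an `n`-simplex, which lies in `H` by the outer induction; at `m = 0` a Moore element is left.
    have key : ∀ m k : ℕ, k + m = n + 1 → ∀ x : X.obj (op (SimplexCategory.mk (n + 1))),
        (∀ i : Fin (n + 1), i.val < k → (X.δ i.castSucc).hom x = 1) → x ∈ H (n + 1) := by
      intro m
      induction m with
      | zero =>
        intro k hk x hx
        exact hN _ (mem_moore_succ.mpr fun i => hx i (by omega))
      | succ m ihm =>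
        intro k hk x hx
        let κ : Fin (n + 1) := ⟨k, by omega⟩
        have h1 : killFace X κ x ∈ H (n + 1) := ihm (k + 1) (by omega) _ fun i hi =>
          δ_killFace X κ x (fun i hi => hx i hi) i (Nat.lt_succ_iff.mp hi)
        have h2 := hσ n κ ((X.δ κ.castSucc).hom x) (by rw [ih]; exact Subgroup.mem_top _)
        have h3 := Subgroup.mul_mem _ h1 h2
        rwa [killFace, inv_mul_cancel_right] at h3
    exact (Subgroup.eq_top_iff' _).mpr fun x => key (n + 1) 0 (by omega) x (by simp)

/-- A surjective morphism of simplicial groups is surjective on Moore complexes. -/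
theorem exists_mem_moore_of_surjective {X Y : SimpGrp.{u}} (f : X ⟶ Y) (n : ℕ)
    (hf : Function.Surjective (f.app (op (SimplexCategory.mk n))).hom)
    (y : Y.obj (op (SimplexCategory.mk n))) (hy : y ∈ moore Y n) :
    ∃ x ∈ moore X n, (f.app (op (SimplexCategory.mk n))).hom x = y := by
  cases n with
  | zero => obtain ⟨x, rfl⟩ := hf y; exact ⟨x, Subgroup.mem_top _, rfl⟩
  | succ n =>
    rw [mem_moore_succ] at hy
    -- Faces of a lift of `y` are killed one by one. The image does not change, since the correction
    -- maps to `s_k d_k y = 1`.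
    have key : ∀ k : ℕ, k ≤ n + 1 → ∃ x : X.obj (op (SimplexCategory.mk (n + 1))),
        (∀ i : Fin (n + 1), i.val < k → (X.δ i.castSucc).hom x = 1) ∧ (f.app _).hom x = y := by
      intro k
      induction k with
      | zero => intro _; obtain ⟨x, rfl⟩ := hf y; exact ⟨x, by simp, rfl⟩
      | succ k ih =>
        intro hk
        obtain ⟨x, hx, rfl⟩ := ih (by omega)
        let κ : Fin (n + 1) := ⟨k, by omega⟩
        refine ⟨killFace X κ x, fun i hi =>
          δ_killFace X κ x (fun i hi => hx i hi) i (Nat.lt_succ_iff.mp hi), ?_⟩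
        rw [killFace, map_mul, map_inv, SimplicialObject.σ_def, naturality_apply,
          SimplicialObject.δ_def, naturality_apply, ← SimplicialObject.δ_def, hy κ, map_one,
          inv_one, mul_one]
    obtain ⟨x, hx, h⟩ := key (n + 1) le_rfl
    exact ⟨x, mem_moore_succ.mpr fun i => hx i i.2, h⟩

/-- The equalizer of `f` and `g` is stable under degeneracies, so it is everything once it contains
the Moore complex. -/
theorem hom_ext_of_moore {X Y : SimpGrp.{u}} (f g : X ⟶ Y)
    (h : ∀ n, ∀ x ∈ moore X n, (f.app (op (SimplexCategory.mk n))).hom x =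
      (g.app (op (SimplexCategory.mk n))).hom x) : f = g := by
  have h1 := eq_top_of_moore_le X
    (fun n => MonoidHom.eqLocus (f.app (op (SimplexCategory.mk n))).hom (g.app _).hom)
    (fun n x hx => h n x hx) (fun n k x hx => by
      change (f.app _).hom _ = (g.app _).hom _
      rw [SimplicialObject.σ_def, naturality_apply, naturality_apply,
        show (f.app _).hom x = (g.app _).hom x from hx])
  apply SimplicialObject.hom_ext
  intro a
  ext x
  have h2 : x ∈ MonoidHom.eqLocus (f.app (op (SimplexCategory.mk a.unop.len))).hom (g.app _).hom := by
    rw [h1]; exact Subgroup.mem_top _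
  exact h2

theorem subsingleton_of_moore {X : SimpGrp.{u}} (h : ∀ n, moore X n = ⊥) (n : ℕ) :
    Subsingleton (X.obj (op (SimplexCategory.mk n))) := by
  have h1 := eq_top_of_moore_le X (fun _ => ⊥) (fun n => (h n).le) (fun n k x hx => by
    rw [Subgroup.mem_bot.mp hx, map_one]; exact Subgroup.one_mem _) n
  exact (Subgroup.subsingleton_iff).mp (subsingleton_of_bot_eq_top h1)

/-! ### Trivial morphisms and zero objects -/

/-- The trivial morphism. -/
def trivialHom (X Y : SimpGrp.{u}) : X ⟶ Y where
  app _ := GrpCat.ofHom 1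
  naturality _ _ f := by
    ext x
    exact (map_one (Y.map f).hom).symm

theorem isZero_of_subsingleton {X : SimpGrp.{u}}
    (h : ∀ n, Subsingleton (X.obj (op (SimplexCategory.mk n)))) : IsZero X := by
  refine ⟨fun Y => ⟨⟨⟨trivialHom X Y⟩, fun f => ?_⟩⟩, fun Y => ⟨⟨⟨trivialHom Y X⟩, fun f => ?_⟩⟩⟩
  · refine hom_ext_of_moore _ _ fun n x _ => ?_
    rw [(h n).elim x 1, map_one, map_one]
  · exact hom_ext_of_moore _ _ fun n x _ => (h n).elim _ _

theorem isZero_iff {X : SimpGrp.{u}} : IsZero X ↔ ∀ n, moore X n = ⊥ := by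
  refine ⟨fun h n => ?_, fun h => isZero_of_subsingleton (subsingleton_of_moore h)⟩
  rw [Subgroup.eq_bot_iff_forall]
  intro x _
  have h1 := h.eq_of_src (𝟙 X) (trivialHom X X)
  exact congrArg (fun f => (f.app (op (SimplexCategory.mk n))).hom x) h1

/-! ### Simplicial subgroups and quotients -/

/-- A family of subgroups that is stable under all simplicial operators. -/
structure SimpSub (X : SimpGrp.{u}) where
  K : ∀ a : SimplexCategory, Subgroup (X.obj (op a))
  map_mem : ∀ {a b : SimplexCategory} (f : a ⟶ b) x, x ∈ K b → (X.map f.op).hom x ∈ K a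

/-- A simplicial subgroup as a simplicial group. -/
def SimpSub.toSimpGrp {X : SimpGrp.{u}} (S : SimpSub X) : SimpGrp.{u} where
  obj a := GrpCat.of (S.K a.unop)
  map {a b} f := GrpCat.ofHom (((X.map f).hom.comp (S.K a.unop).subtype).codRestrict (S.K b.unop)
    fun x => S.map_mem f.unop x.1 x.2)
  map_id a := by
    ext x
    exact congrArg (fun f => f.hom x.1) (X.map_id a)
  map_comp f g := by
    ext x
    exact congrArg (fun f => f.hom x.1) (X.map_comp f g)

/-- The inclusion of a simplicial subgroup. -/
def SimpSub.incl {X : SimpGrp.{u}} (S : SimpSub X) : S.toSimpGrp ⟶ X where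
  app a := GrpCat.ofHom (S.K a.unop).subtype

/-- The quotient of a simplicial group by a normal simplicial subgroup. -/
def SimpSub.quot {X : SimpGrp.{u}} (S : SimpSub X) [∀ a, (S.K a).Normal] : SimpGrp.{u} where
  obj a := GrpCat.of (X.obj a ⧸ S.K a.unop)
  map {a b} f := GrpCat.ofHom (QuotientGroup.map (S.K a.unop) (S.K b.unop) (X.map f).hom
    fun x hx => S.map_mem f.unop x hx)
  map_id a := by
    ext x
    exact congrArg (fun f => QuotientGroup.mk (f.hom x)) (X.map_id a)
  map_comp f g := by
    ext x
    exact congrArg (fun f => QuotientGroup.mk (f.hom x)) (X.map_comp f g)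

/-- The quotient morphism. -/
def SimpSub.proj {X : SimpGrp.{u}} (S : SimpSub X) [∀ a, (S.K a).Normal] : X ⟶ S.quot where
  app a := GrpCat.ofHom (QuotientGroup.mk' (S.K a.unop))

/-! ### Simplices with trivial faces -/

/-- An operator from a smaller ordinal is not onto, hence factors through a coface and starts by
taking a face of `x`. -/
theorem map_eq_one_of_not_surjective (X : SimpGrp.{u}) {n : ℕ} {a : SimplexCategory}
    (θ : a ⟶ SimplexCategory.mk (n + 1)) (hθ : a.len < n + 1)
    (x : X.obj (op (SimplexCategory.mk (n + 1)))) (hx : ∀ i, (X.δ i).hom x = 1) :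
    (X.map θ.op).hom x = 1 := by
  obtain ⟨i, θ', rfl⟩ := SimplexCategory.eq_comp_δ_of_not_surjective θ fun h => by
    have := Fintype.card_le_of_surjective _ h
    simp at this
    omega
  rw [map_comp_apply, ← SimplicialObject.δ_def, hx, map_one]

theorem δ_δ_last_eq_one (X : SimpGrp.{u}) {n : ℕ} (x : X.obj (op (SimplexCategory.mk (n + 2))))
    (hx : x ∈ moore X (n + 2)) (i : Fin (n + 2)) :
    (X.δ i).hom ((X.δ (Fin.last (n + 2))).hom x) = 1 := by
  rw [← Fin.succ_last, δ_δ_apply X (Fin.le_last i), mem_moore_succ.mp hx, map_one]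

/-- The operator starts with a face. Only the last face of a Moore element can be nontrivial, and
all faces of that face vanish; since `a.len < n`, at least one more face has to be taken. -/
theorem map_moore_eq_one (X : SimpGrp.{u}) {n : ℕ} {a : SimplexCategory}
    (θ : a ⟶ SimplexCategory.mk (n + 1)) (hθ : a.len < n)
    (x : X.obj (op (SimplexCategory.mk (n + 1)))) (hx : x ∈ moore X (n + 1)) :
    (X.map θ.op).hom x = 1 := by
  obtain ⟨n, rfl⟩ : ∃ m, n = m + 1 := ⟨n - 1, by omega⟩
  obtain ⟨i, θ', rfl⟩ := SimplexCategory.eq_comp_δ_of_not_surjective θ fun h => by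
    have := Fintype.card_le_of_surjective _ h
    simp at this
    omega
  rw [map_comp_apply, ← SimplicialObject.δ_def]
  refine Fin.lastCases ?_ (fun i => ?_) i
  · exact map_eq_one_of_not_surjective X θ' hθ _ (δ_δ_last_eq_one X x hx)
  · rw [mem_moore_succ.mp hx, map_one]

/-! ### The torsion-free class of `μ_{≥ n+1}` -/

theorem truncation_map_eq_iff {X Y : SimpGrp.{u}} (n : ℕ) (f g : X ⟶ Y) :
    (SimplicialObject.truncation n).map f = (SimplicialObject.truncation n).map g ↔
      ∀ a : SimplexCategory, a.len ≤ n → ∀ x, (f.app (op a)).hom x = (g.app (op a)).hom x := by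
  constructor
  · intro h a ha x
    exact congrArg (fun φ => (φ.app (op (⟨a, ha⟩ : SimplexCategory.Truncated n))).hom x) h
  · intro h
    ext a x
    exact h a.unop.obj a.unop.property x

/-- Composition of `f` with the unit is the adjoint transpose of the truncation of `f`. A monic unit
therefore means that truncation is injective on morphisms into `X`, and the coskeleton never has to
be computed. -/
theorem fTr_iff_faithful {X : SimpGrp.{u}} (n : ℕ) :
    fTr n X ↔ ∀ (Z : SimpGrp.{u}) (f g : Z ⟶ X),
      (SimplicialObject.truncation n).map f = (SimplicialObject.truncation n).map g → f = g := by
  have key : ∀ (Z : SimpGrp.{u}) (f g : Z ⟶ X),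
      (SimplicialObject.truncation n).map f = (SimplicialObject.truncation n).map g ↔
        f ≫ (SimplicialObject.coskAdj (C := GrpCat.{u}) n).unit.app X =
          g ≫ (SimplicialObject.coskAdj (C := GrpCat.{u}) n).unit.app X := fun Z f g => by
    rw [← ((SimplicialObject.coskAdj (C := GrpCat.{u}) n).homEquiv Z _).injective.eq_iff,
      Adjunction.homEquiv_unit, Adjunction.homEquiv_unit,
      ← Adjunction.unit_naturality, ← Adjunction.unit_naturality]
  exact ⟨fun h Z f g hfg => h.right_cancellation f g ((key Z f g).mp hfg),
    fun h => ⟨fun f g hfg => h _ f g ((key _ f g).mpr hfg)⟩⟩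

theorem fTr_iff {X : SimpGrp.{u}} (n : ℕ) :
    fTr n X ↔ (∀ x ∈ moore X (n + 1), (X.δ (Fin.last (n + 1))).hom x = 1 → x = 1) ∧
      ∀ i, n + 1 < i → moore X i = ⊥ := by
  rw [fTr_iff_faithful]
  constructor
  · intro h
    -- The largest simplicial subgroup that is trivial in dimensions at most `n`. Its inclusion has
    -- the same truncation as the trivial morphism, so it must be trivial.
    let S : SimpSub X :=
      { K := fun a =>
          { carrier := {x | ∀ (b : SimplexCategory) (θ : b ⟶ a), b.len ≤ n →
              (X.map θ.op).hom x = 1}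
            one_mem' := fun b θ _ => map_one _
            mul_mem' := fun hx hy b θ hb => by rw [map_mul, hx b θ hb, hy b θ hb, one_mul]
            inv_mem' := fun hx b θ hb => by rw [map_inv, hx b θ hb, inv_one] }
        map_mem := fun f x hx b θ hb => by rw [← map_comp_apply]; exact hx b _ hb }
    have h1 : S.incl = trivialHom _ X := h _ _ _ ((truncation_map_eq_iff n _ _).mpr
      fun a ha x => (congrArg (fun f => f.hom x.1) (X.map_id (op a))).symm.trans (x.2 a (𝟙 a) ha))
    have h2 : ∀ (a : SimplexCategory) (x : X.obj (op a)), x ∈ S.K a → x = 1 := fun a x hx =>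
      congrArg (fun f => (f.app (op a)).hom ⟨x, hx⟩) h1
    refine ⟨fun x hx hd => h2 _ x fun b θ hb => ?_, fun i hi => ?_⟩
    · exact map_eq_one_of_not_surjective X θ (by omega) x
        (fun i => Fin.lastCases hd (mem_moore_succ.mp hx) i)
    · obtain ⟨i, rfl⟩ : ∃ j, i = j + 1 := ⟨i - 1, by omega⟩
      exact (Subgroup.eq_bot_iff_forall _).mpr fun x hx => h2 _ x fun b θ hb =>
        map_moore_eq_one X θ (by omega) x hx
  · rintro ⟨h1, h2⟩ Z f g hfg
    rw [truncation_map_eq_iff] at hfg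
    refine hom_ext_of_moore f g fun i x hx => ?_
    rcases lt_trichotomy i (n + 1) with hi | rfl | hi
    · exact hfg _ (Nat.lt_succ_iff.mp hi) x
    · rw [← div_eq_one]
      refine h1 _ (Subgroup.div_mem _ (map_mem_moore f hx) (map_mem_moore g hx)) ?_
      -- The last face of `f x / g x` depends only on `f` and `g` in dimension `n`, where they
      -- agree.
      rw [map_div, div_eq_one, SimplicialObject.δ_def, ← naturality_apply, ← naturality_apply]
      exact hfg _ le_rfl _
    · have hf := map_mem_moore f hx
      have hg := map_mem_moore g hx
      rw [h2 i hi, Subgroup.mem_bot] at hf hg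
      rw [hf, hg]

/-! ### The torsion class of `μ_{n ≥}` -/

/-- The boundaries `δ_{n+1}(N(X)_{n+1})` in `X_n`. -/
def boundaries (X : SimpGrp.{u}) (n : ℕ) : Subgroup (X.obj (op (SimplexCategory.mk n))) :=
  (moore X (n + 1)).map (X.δ (Fin.last (n + 1))).hom

instance moore_normal (X : SimpGrp.{u}) (n : ℕ) : (moore X n).Normal := by
  cases n with
  | zero => exact inferInstanceAs (⊤ : Subgroup _).Normal
  | succ n => exact Subgroup.normal_iInf_normal fun i => inferInstance

/-- The last face map is onto, being split by a degeneracy, so it preserves normality. -/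
instance boundaries_normal (X : SimpGrp.{u}) (n : ℕ) : (boundaries X n).Normal := by
  refine Subgroup.Normal.map inferInstance _ fun x => ⟨(X.σ (Fin.last n)).hom x, ?_⟩
  have h := X.δ_comp_σ_succ (i := Fin.last n)
  rw [Fin.succ_last] at h
  exact congrArg (fun f => f.hom x) h

theorem map_boundaries (X : SimpGrp.{u}) {n : ℕ} {a : SimplexCategory} (ha : a.len < n)
    (θ : a ⟶ SimplexCategory.mk n) (x : X.obj (op (SimplexCategory.mk n)))
    (hx : x ∈ boundaries X n) : (X.map θ.op).hom x = 1 := by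
  obtain ⟨n, rfl⟩ : ∃ m, n = m + 1 := ⟨n - 1, by omega⟩
  obtain ⟨y, hy, rfl⟩ := hx
  exact map_eq_one_of_not_surjective X θ ha _ (δ_δ_last_eq_one X y hy)

/-- A surjective endomorphism of `[n]` is the identity; any other one factors through a coface, and
all faces of a boundary are trivial. -/
theorem map_endo_boundaries (X : SimpGrp.{u}) {n : ℕ}
    (θ : SimplexCategory.mk n ⟶ SimplexCategory.mk n) (x : X.obj (op (SimplexCategory.mk n)))
    (hx : x ∈ boundaries X n) : (X.map θ.op).hom x ∈ boundaries X n := by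
  by_cases h : Function.Surjective θ.toOrderHom
  · have : Epi θ := SimplexCategory.epi_iff_surjective.mpr h
    rw [SimplexCategory.eq_id_of_epi θ, op_id, X.map_id]
    exact hx
  · cases n with
    | zero => exact absurd (fun y => ⟨y, Subsingleton.elim (α := Fin 1) _ _⟩) h
    | succ n =>
      obtain ⟨i, θ', rfl⟩ := SimplexCategory.eq_comp_δ_of_not_surjective θ h
      rw [map_comp_apply, map_boundaries X (by simp) _ x hx, map_one]
      exact Subgroup.one_mem _

/-- The kernel of the unit of the cotruncation. -/
def cotSub (X : SimpGrp.{u}) (n : ℕ) : SimpSub X where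
  K a :=
    { carrier := {x | ∀ θ : SimplexCategory.mk n ⟶ a, (X.map θ.op).hom x ∈ boundaries X n}
      one_mem' := fun θ => by rw [map_one]; exact Subgroup.one_mem _
      mul_mem' := fun hx hy θ => by rw [map_mul]; exact Subgroup.mul_mem _ (hx θ) (hy θ)
      inv_mem' := fun hx θ => by rw [map_inv]; exact Subgroup.inv_mem _ (hx θ) }
  map_mem f x hx θ := by rw [← map_comp_apply]; exact hx _

instance (X : SimpGrp.{u}) (n : ℕ) (a : SimplexCategory) : ((cotSub X n).K a).Normal :=
  ⟨fun x hx g θ => by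
    rw [map_mul, map_mul, map_inv]
    exact (boundaries_normal X n).conj_mem _ (hx θ) _⟩

/-- Above degree `n + 1`, operators from `[n]` kill Moore elements. In degree `n + 1` only the last
face survives; it is a boundary, and endomorphisms of `[n]` preserve boundaries. -/
theorem moore_le_cotSub (X : SimpGrp.{u}) {n i : ℕ} (h : n < i) :
    moore X i ≤ (cotSub X n).K (SimplexCategory.mk i) := by
  intro x hx θ
  obtain ⟨i, rfl⟩ : ∃ j, i = j + 1 := ⟨i - 1, by omega⟩
  rcases (Nat.lt_succ_iff.mp h).lt_or_eq with h | rfl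
  · rw [map_moore_eq_one X θ h x hx]; exact Subgroup.one_mem _
  · obtain ⟨k, θ', rfl⟩ := SimplexCategory.eq_comp_δ_of_not_surjective θ fun h => by
      have := Fintype.card_le_of_surjective _ h
      simp at this
    rw [map_comp_apply, ← SimplicialObject.δ_def]
    refine Fin.lastCases ?_ (fun k => ?_) k
    · exact map_endo_boundaries X θ' _ ⟨x, hx, rfl⟩
    · rw [mem_moore_succ.mp hx, map_one]; exact Subgroup.one_mem _

theorem mLE_quot_cotSub (X : SimpGrp.{u}) (n : ℕ) : mLE n (cotSub X n).quot := by
  intro i hi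
  refine (Subgroup.eq_bot_iff_forall _).mpr fun y hy => ?_
  obtain ⟨x, hx, rfl⟩ := exists_mem_moore_of_surjective (cotSub X n).proj i
    (QuotientGroup.mk'_surjective _) y hy
  exact (QuotientGroup.eq_one_iff x).mpr (moore_le_cotSub X hi hx)

/-- The inclusion of an initial segment is split by truncation with `min`. This makes `X_i` a
retract of `X_n`, so that information in dimension `n` passes down. -/
theorem exists_section {n i : ℕ} (h : i ≤ n) :
    ∃ (s : SimplexCategory.mk i ⟶ SimplexCategory.mk n)
      (p : SimplexCategory.mk n ⟶ SimplexCategory.mk i), s ≫ p = 𝟙 _ := by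
  refine ⟨SimplexCategory.mkHom (Fin.castLEOrderEmb (by omega)).toOrderHom,
    SimplexCategory.mkHom ⟨fun k => ⟨min k.val i, by omega⟩, fun a b hab => ?_⟩, ?_⟩
  · rw [Fin.le_def] at hab ⊢; simp; omega
  · ext k
    have := k.2
    simp at this
    change min k.val i = k.val
    omega

/-- The condition says that every morphism from `X` to `M_{n ≥}` is trivial. Tested on the quotient
by `cotSub`, it forces all of `X_n` to consist of boundaries. Conversely, boundaries in degree `n`
come from degree `n + 1`, where the target has trivial Moore complex. -/
theorem kerCot_iff {X : SimpGrp.{u}} (n : ℕ) :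
    kerCot n X ↔ (∀ i, i < n → moore X i = ⊥) ∧ moore X n ≤ boundaries X n := by
  constructor
  · rintro ⟨Y, η, _, hY, h⟩
    have h1 : (cotSub X n).proj = trivialHom _ _ := by
      obtain ⟨g, hg⟩ := (h _ (mLE_quot_cotSub X n)).2 (cotSub X n).proj
      obtain ⟨g', hg'⟩ := (h _ (mLE_quot_cotSub X n)).2 (trivialHom X (cotSub X n).quot)
      rw [← hg, ← hg', hY.eq_of_src g g']
    have h2 : ∀ (a : SimplexCategory) (x : X.obj (op a)), x ∈ (cotSub X n).K a := fun a x =>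
      (QuotientGroup.eq_one_iff x).mp (congrArg (fun f => (f.app (op a)).hom x) h1)
    have h3 : ∀ x, x ∈ boundaries X n := fun x => by
      have := h2 _ x (𝟙 (SimplexCategory.mk n))
      rwa [op_id, X.map_id] at this
    -- Pulled back along `p`, an `i`-simplex becomes a boundary in dimension `n`. Restriction along
    -- `s` recovers it, but also kills boundaries because `i < n`.
    refine ⟨fun i hi => (Subgroup.eq_bot_iff_forall _).mpr fun x _ => ?_, fun x _ => h3 x⟩
    obtain ⟨s, p, hsp⟩ := exists_section hi.le
    have h4 := map_boundaries X hi s _ (h3 ((X.map p.op).hom x))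
    rw [← map_comp_apply, hsp, op_id, X.map_id] at h4
    exact h4
  · rintro ⟨h1, h2⟩
    have h3 : ∀ Z : SimpGrp.{u}, mLE n Z → ∀ f : X ⟶ Z, f = trivialHom X Z := fun Z hZ f => by
      refine hom_ext_of_moore _ _ fun i x hx => ?_
      rcases lt_trichotomy i n with hi | rfl | hi
      · rw [h1 i hi, Subgroup.mem_bot] at hx
        rw [hx, map_one, map_one]
      · obtain ⟨y, hy, rfl⟩ := h2 hx
        have h4 := map_mem_moore f hy
        rw [hZ (i + 1) (by omega), Subgroup.mem_bot] at h4
        rw [SimplicialObject.δ_def, naturality_apply, h4, map_one]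
        rfl
      · have h4 := map_mem_moore f hx
        rw [hZ i hi, Subgroup.mem_bot] at h4
        rw [h4]
        rfl
    let Y : SimpGrp.{u} := (Functor.const _).obj (GrpCat.of PUnit)
    have hY : IsZero Y := isZero_of_subsingleton fun _ => inferInstanceAs (Subsingleton PUnit)
    refine ⟨Y, trivialHom X Y, fun i _ => isZero_iff.mp hY i, hY, fun Z hZ =>
      ⟨fun g g' _ => hY.eq_of_src g g', fun f => ⟨trivialHom Y Z, ?_⟩⟩⟩
    exact (h3 Z hZ _).trans (h3 Z hZ f).symm

end SimpGrp

/-! ### Morphisms and isomorphisms of crossed complexes, degreewise. -/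

namespace CrsGrp

theorem hom_ext' {M N : CrsGrp.{u}} {f g : M ⟶ N} (h : ∀ i x, Hom.f f i x = Hom.f g i x) :
    f = g :=
  Hom.ext (funext fun i => MonoidHom.ext (h i))

theorem hom_inv_apply {M N : CrsGrp.{u}} (e : M ≅ N) (i : ℕ) (x : M.X i) :
    Hom.f e.inv i (Hom.f e.hom i x) = x :=
  congrArg (fun f => Hom.f f i x) e.hom_inv_id

/-- The components of an isomorphism. -/
def isoEquiv {M N : CrsGrp.{u}} (e : M ≅ N) (i : ℕ) : M.X i ≃* N.X i where
  toFun := Hom.f e.hom i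
  invFun := Hom.f e.inv i
  left_inv := hom_inv_apply e i
  right_inv := hom_inv_apply e.symm i
  map_mul' := map_mul _

theorem isoEquiv_d {M N : CrsGrp.{u}} (e : M ≅ N) (i : ℕ) (x : M.X (i + 1)) :
    isoEquiv e i (M.d i x) = N.d i (isoEquiv e (i + 1) x) :=
  Hom.comm_d e.hom i x

/-! ### Subcomplexes -/

/-- A normal subcomplex as a crossed complex. -/
def NormalSub.toCrs {M : CrsGrp.{u}} (S : NormalSub M) : CrsGrp.{u} where
  X i := S.K i
  d i := ((M.d i).comp (S.K (i + 1)).subtype).codRestrict (S.K i) fun x => S.d_mem i x.1 x.2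
  d_d i x := Subtype.ext (M.d_d i x.1)
  act i g x := ⟨M.act i g.1 x.1, S.act_mem i g.1 x.1 x.2⟩
  act_zero g x := Subtype.ext (M.act_zero g.1 x.1)
  one_act i x := Subtype.ext (M.one_act i x.1)
  mul_act i g h x := Subtype.ext (M.mul_act i g.1 h.1 x.1)
  act_mul i g x y := Subtype.ext (M.act_mul i g.1 x.1 y.1)
  d_act i g x := Subtype.ext (M.d_act i g.1 x.1)
  peiffer x y := Subtype.ext (M.peiffer x.1 y.1)
  comm i x y := Subtype.ext (M.comm i x.1 y.1)
  act_d i x y := Subtype.ext (M.act_d i x.1 y.1)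

/-- The inclusion of a normal subcomplex. -/
def NormalSub.incl {M : CrsGrp.{u}} (S : NormalSub M) : S.toCrs ⟶ M where
  f i := (S.K i).subtype
  comm_d _ _ := rfl
  map_act _ _ _ := rfl

/-- The projection to the quotient by a normal subcomplex. -/
def NormalSub.proj {M : CrsGrp.{u}} (S : NormalSub M) : M ⟶ M.quot S where
  f i := QuotientGroup.mk' (S.K i)
  comm_d _ _ := rfl
  map_act _ _ _ := rfl

theorem NormalSub.incl_proj {M : CrsGrp.{u}} (S : NormalSub M) : S.incl ≫ S.proj = 0 :=
  hom_ext' fun i x => (QuotientGroup.eq_one_iff (N := S.K i) x.1).mpr x.2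

/-- Morphisms whose values lie in a normal subcomplex factor through it. -/
def NormalSub.lift {M W : CrsGrp.{u}} (S : NormalSub M) (g : W ⟶ M)
    (hg : ∀ i x, Hom.f g i x ∈ S.K i) : W ⟶ S.toCrs where
  f i := (Hom.f g i).codRestrict (S.K i) (hg i)
  comm_d i x := Subtype.ext (Hom.comm_d g i x)
  map_act i h x := Subtype.ext (Hom.map_act g i h x)

/-- Morphisms that are trivial on a normal subcomplex factor through the quotient. -/
def NormalSub.desc {M W : CrsGrp.{u}} (S : NormalSub M) (g : M ⟶ W)
    (hg : ∀ i x, x ∈ S.K i → Hom.f g i x = 1) : M.quot S ⟶ W where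
  f i := QuotientGroup.lift (S.K i) (Hom.f g i) (hg i)
  comm_d i x := by
    induction x using QuotientGroup.induction_on with
    | H x => exact Hom.comm_d g i x
  map_act i h x := by
    induction h using QuotientGroup.induction_on with
    | H h =>
    induction x using QuotientGroup.induction_on with
    | H x => exact Hom.map_act g i h x

/-- The normal subcomplex consisting of everything. -/
def topSub (M : CrsGrp.{u}) : NormalSub M where
  K _ := ⊤
  normal _ := inferInstance
  d_mem _ _ _ := Subgroup.mem_top _
  act_mem _ _ _ _ := Subgroup.mem_top _
  act_div_mem _ _ _ _ := Subgroup.mem_top _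

theorem cycles_normal (M : CrsGrp.{u}) (i : ℕ) : (M.cycles i).Normal := by
  cases i with
  | zero => exact inferInstanceAs (⊤ : Subgroup _).Normal
  | succ i => exact inferInstanceAs (M.d i).ker.Normal

/-- The kernel of the unit `M ⟶ cosk_n(tr_n(M))`. -/
def trSub (n : ℕ) (M : CrsGrp.{u}) : NormalSub M where
  K i := if i ≤ n then ⊥ else if i = n + 1 then M.cycles i else ⊤
  normal i := by
    split_ifs
    · infer_instance
    · exact M.cycles_normal i
    · infer_instance
  d_mem i x hx := by
    split_ifs at hx ⊢ <;> first | omega | skip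
    · rw [Subgroup.mem_bot.mp hx, map_one]; exact Subgroup.one_mem _
    · exact hx
    · exact M.d_mem_cycles i x
    · exact Subgroup.mem_top _
  act_mem i g x hx := by
    split_ifs at hx ⊢
    · rw [Subgroup.mem_bot.mp hx, M.act_one]; exact Subgroup.one_mem _
    · exact M.act_mem_cycles i g x hx
    · exact Subgroup.mem_top _
  act_div_mem i g x hg := by
    rw [if_pos n.zero_le, Subgroup.mem_bot] at hg
    rw [hg, M.one_act, mul_inv_cancel]
    exact Subgroup.one_mem _

theorem crsLE_toCrs {n : ℕ} {M : CrsGrp.{u}} (h : crsLE n M) (S : NormalSub M) :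
    crsLE n S.toCrs := fun i hi =>
  have := h i hi
  inferInstanceAs (Subsingleton (S.K i))

theorem crsLE_quot {n : ℕ} {M : CrsGrp.{u}} (h : crsLE n M) (S : NormalSub M) :
    crsLE n (M.quot S) := fun i hi =>
  have := h i hi
  Quot.Subsingleton

/-! ### The classes of the torsion theories -/

theorem isZero_iff {M : CrsGrp.{u}} : IsZero M ↔ ∀ i, Subsingleton (M.X i) := by
  rw [IsZero.iff_id_eq_zero]
  refine ⟨fun h i => ⟨fun x y => ?_⟩, fun h => hom_ext' fun i x => (h i).elim _ _⟩
  have h1 : ∀ x : M.X i, x = 1 := fun x => congrArg (fun f : M ⟶ M => Hom.f f i x) h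
  rw [h1 x, h1 y]

theorem isZero_fullSubcategory_iff {n : ℕ} (M : (crsLE.{u} n).FullSubcategory) :
    IsZero M ↔ IsZero M.obj := by
  rw [IsZero.iff_id_eq_zero, IsZero.iff_id_eq_zero]
  exact ⟨fun h => congrArg (fun f => f.hom) h, fun h => ObjectProperty.hom_ext _ h⟩

/-- The unit kills the inclusion of `trSub`, so a monic unit makes `trSub` trivial. Conversely,
cancellation uses the first coordinate of the unit in positive degrees up to `n`, where it is the
identity, and the second coordinate `d n` in degree `n + 1`. -/
theorem fTr_iff {n : ℕ} {M : CrsGrp.{u}} :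
    fTr n M ↔ (∀ x, M.d n x = 1 → x = 1) ∧ ∀ i, n + 1 < i → Subsingleton (M.X i) := by
  constructor
  · intro h
    have h1 : (trSub n M).incl = 0 := by
      apply h.right_cancellation
      rw [zero_comp]
      refine hom_ext' fun i x => ?_
      obtain ⟨x, hx⟩ := x
      cases i with
      | zero => exact Subgroup.mem_bot.mp hx
      | succ i =>
        change x ∈ (if i + 1 ≤ n then ⊥ else if i + 1 = n + 1 then M.cycles (i + 1) else ⊤) at hx
        refine coskX_ext ?_ ?_
        · change (if i < n then MonoidHom.id (M.X (i + 1)) else 1) x = 1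
          split_ifs with h2
          · rw [if_pos (Nat.succ_le_of_lt h2)] at hx
            exact hx
          · rfl
        · change (if i ≤ n then M.d i else 1) x = 1
          split_ifs with h2
          · rcases h2.lt_or_eq with h3 | rfl
            · rw [if_pos (Nat.succ_le_of_lt h3)] at hx
              rw [Subgroup.mem_bot.mp hx, map_one]
            · rw [if_neg (by omega), if_pos rfl] at hx
              exact hx
          · rfl
    have h2 : ∀ i x, x ∈ (trSub n M).K i → x = 1 := fun i x hx =>
      congrArg (fun f : (trSub n M).toCrs ⟶ M =>
        Hom.f f i (⟨x, hx⟩ : (trSub n M).K i)) h1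
    refine ⟨fun x hx => h2 _ x ?_, fun i hi => ⟨fun x y => ?_⟩⟩
    · simp only [trSub]
      rw [if_neg (by omega), if_pos trivial]
      exact hx
    · have h3 : (trSub n M).K i = ⊤ := by
        simp only [trSub]
        rw [if_neg (by omega), if_neg (by omega)]
      rw [h2 i x (h3 ▸ Subgroup.mem_top _), h2 i y (h3 ▸ Subgroup.mem_top _)]
  · rintro ⟨h1, h2⟩
    refine ⟨fun {W} f g h => hom_ext' fun i x => ?_⟩
    have h3 := congrArg (fun f => Hom.f f i x) h
    cases i with
    | zero => exact h3
    | succ i =>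
      rcases lt_trichotomy i n with hi | rfl | hi
      · have h4 : (if i < n then MonoidHom.id (M.X (i + 1)) else 1) (Hom.f f (i + 1) x) =
            (if i < n then MonoidHom.id (M.X (i + 1)) else 1) (Hom.f g (i + 1) x) :=
          congrArg (fun p : coskSub n M i => p.1.1) h3
        rwa [if_pos hi] at h4
      · have h4 : (if i ≤ i then M.d i else 1) (Hom.f f (i + 1) x) =
            (if i ≤ i then M.d i else 1) (Hom.f g (i + 1) x) :=
          congrArg (fun p : coskSub i M i => p.1.2) h3
        rw [if_pos le_rfl, ← div_eq_one, ← map_div] at h4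
        exact div_eq_one.mp (h1 _ h4)
      · exact (h2 _ (by omega)).elim _ _

theorem kerCot_iff {n : ℕ} {M : CrsGrp.{u}} :
    kerCot n M ↔ (∀ i, i < n → Subsingleton (M.X i)) ∧ Function.Surjective (M.d n) := by
  have h0 : kerCot n M ↔ ∀ i x, x ∈ (cotSub n M).K i := by
    rw [kerCot, isZero_fullSubcategory_iff, isZero_iff]
    refine forall_congr' fun i => ?_
    change Subsingleton (M.X i ⧸ (cotSub n M).K i) ↔ _
    rw [QuotientGroup.subsingleton_iff, Subgroup.eq_top_iff']
  rw [h0]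
  simp only [cotSub]
  constructor
  · refine fun h => ⟨fun i hi => ⟨fun x y => ?_⟩, fun x => ?_⟩
    · have h1 := h i
      rw [if_pos hi] at h1
      rw [Subgroup.mem_bot.mp (h1 x), Subgroup.mem_bot.mp (h1 y)]
    · have h1 := h n x
      rwa [if_neg (lt_irrefl n), if_pos rfl] at h1
  · rintro ⟨h1, h2⟩ i x
    split_ifs with h3 h4
    · exact (h1 i h3).elim _ _
    · subst h4; exact h2 x
    · exact Subgroup.mem_top _

instance mu_T_closed (k : MuIndex) : (mu.{u} k).T.IsClosedUnderIsomorphisms where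
  of_iso {M N} e h := by
    cases k with
    | zero => exact IsZero.of_iso h e.symm
    | geSucc i => exact fun j hj => (isoEquiv e j).toEquiv.subsingleton_congr.mp (h j hj)
    | le i => exact IsZero.of_iso h ((cot i).mapIso e.symm)
    | all => trivial

instance mu_F_closed (k : MuIndex) : (mu.{u} k).F.IsClosedUnderIsomorphisms where
  of_iso {M N} e h := by
    cases k with
    | zero => trivial
    | geSucc i =>
      obtain ⟨h1, h2⟩ := fTr_iff.mp h
      refine fTr_iff.mpr ⟨fun x hx => ?_, fun j hj =>
        (isoEquiv e j).toEquiv.subsingleton_congr.mp (h2 j hj)⟩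
      have h3 := isoEquiv_d e.symm i x
      rw [hx, map_one] at h3
      exact (MulEquiv.map_eq_one_iff _).mp (h1 _ h3.symm)
    | le i => exact fun j hj => (isoEquiv e j).toEquiv.subsingleton_congr.mp (h j hj)
    | all => exact IsZero.of_iso h e.symm

/-- Only one degree needs an argument. For `geSucc i` it is `i + 1`: there `d f = f d = 1`, and `d`
is injective on the target. For `le i` it is `i`: there every element is a boundary from degree `i +
1`, where the target vanishes. -/
theorem mu_hom_eq_zero (k : MuIndex) {A B : CrsGrp.{u}} (hA : (mu k).T A) (hB : (mu k).F B)
    (f : A ⟶ B) : f = 0 := by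
  cases k with
  | zero => exact IsZero.eq_of_src hA _ _
  | all => exact IsZero.eq_of_tgt hB _ _
  | geSucc i =>
    obtain ⟨h1, h2⟩ := fTr_iff.mp hB
    have h3 : ∀ j, j < i + 1 → ∀ x, Hom.f f j x = 1 := fun j hj x => by
      rw [(hA j hj).elim x 1, map_one]
    refine hom_ext' fun j x => ?_
    rcases lt_trichotomy j (i + 1) with hj | rfl | hj
    · exact h3 j hj x
    · exact h1 _ ((Hom.comm_d f i x).symm.trans (h3 i (Nat.lt_succ_self i) _))
    · exact (h2 j hj).elim _ _
  | le i =>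
    obtain ⟨h1, h2⟩ := kerCot_iff.mp hA
    refine hom_ext' fun j x => ?_
    rcases lt_trichotomy j i with hj | rfl | hj
    · rw [(h1 j hj).elim x 1, map_one, map_one]
    · obtain ⟨y, rfl⟩ := h2 x
      rw [Hom.comm_d, (hB (j + 1) (Nat.lt_succ_self j)).elim (Hom.f f (j + 1) y) 1, map_one]
      rfl
    · exact (hB j hj).elim _ _

/-- The torsion subobject, except for the torsion theory `0`. -/
theorem exists_normalSub (k : MuIndex) (hk : k ≠ .zero) (M : CrsGrp.{u}) :
    ∃ S : NormalSub M, (mu k).T S.toCrs ∧ (mu k).F (M.quot S) := by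
  cases k with
  | zero => exact absurd rfl hk
  | all =>
    refine ⟨topSub M, trivial, isZero_iff.mpr fun i => ?_⟩
    exact QuotientGroup.subsingleton_quotient_top
  | geSucc i =>
    refine ⟨trSub i M, fun j hj => ?_, fTr_iff.mpr ⟨fun x hx => ?_, fun j hj => ?_⟩⟩
    · have h : (trSub i M).K j = ⊥ := if_pos (Nat.lt_succ_iff.mp hj)
      change Subsingleton ((trSub i M).K j)
      rw [h]
      infer_instance
    · induction x using QuotientGroup.induction_on with
      | H x =>
        -- The subcomplex is trivial in degree `i`, so `x` is a cycle already in `M`, hence lies in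
        -- the subcomplex.
        have h : M.d i x ∈ (trSub i M).K i := (QuotientGroup.eq_one_iff _).mp hx
        refine (QuotientGroup.eq_one_iff (N := (trSub i M).K (i + 1)) x).mpr ?_
        simp only [trSub] at h ⊢
        rw [if_pos le_rfl] at h
        rw [if_neg (by omega), if_pos trivial]
        exact h
    · have h : (trSub i M).K j = ⊤ := by
        simp only [trSub]
        rw [if_neg (by omega), if_neg (by omega)]
      change Subsingleton (M.X j ⧸ (trSub i M).K j)
      rw [h]
      exact QuotientGroup.subsingleton_quotient_top
  | le i =>
    refine ⟨cotSub i M, kerCot_iff.mpr ⟨fun j hj => ?_, fun x => ?_⟩, ((cot i).obj M).property⟩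
    · have h : (cotSub i M).K j = ⊥ := if_pos hj
      change Subsingleton ((cotSub i M).K j)
      rw [h]
      infer_instance
    · obtain ⟨x, hx⟩ := x
      have h1 : (cotSub i M).K i = (M.d i).range := by simp [cotSub]
      have h2 : (cotSub i M).K (i + 1) = ⊤ := by simp [cotSub]
      -- The subcomplex is everything in degree `i + 1`, so a preimage in `M` is a preimage in the
      -- subcomplex.
      obtain ⟨y, rfl⟩ : x ∈ (M.d i).range := h1 ▸ hx
      exact ⟨⟨y, h2 ▸ Subgroup.mem_top _⟩, rfl⟩

theorem exists_ses {n : ℕ} (M : (crsLE.{u} n).FullSubcategory) (S : NormalSub M.obj) :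
    ∃ (ε : (⟨S.toCrs, crsLE_toCrs M.property S⟩ : (crsLE.{u} n).FullSubcategory) ⟶ M)
      (η : M ⟶ (⟨M.obj.quot S, crsLE_quot M.property S⟩ : (crsLE.{u} n).FullSubcategory))
      (w : ε ≫ η = 0), Nonempty (IsLimit (KernelFork.ofι ε w)) ∧
        Nonempty (IsColimit (CokernelCofork.ofπ η w)) := by
  refine ⟨ObjectProperty.homMk S.incl, ObjectProperty.homMk S.proj,
    ObjectProperty.hom_ext _ S.incl_proj, ⟨?_⟩, ⟨?_⟩⟩
  · refine KernelFork.IsLimit.ofι _ _ (fun g hg => ObjectProperty.homMk (S.lift g.hom fun i x => ?_))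
      (fun g hg => rfl) (fun g hg m hm => ?_)
    · exact (QuotientGroup.eq_one_iff (N := S.K i) _).mp
        (congrArg (fun f => Hom.f f.hom i x) hg)
    · exact ObjectProperty.hom_ext _ (hom_ext' fun i x =>
        Subtype.ext (congrArg (fun f => Hom.f f.hom i x) hm))
  · refine CokernelCofork.IsColimit.ofπ _ _
      (fun g hg => ObjectProperty.homMk (S.desc g.hom fun i x hx => ?_))
      (fun g hg => rfl) (fun g hg m hm => ?_)
    · exact congrArg (fun f => Hom.f (M := S.toCrs) f.hom i (⟨x, hx⟩ : S.K i)) hg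
    · refine ObjectProperty.hom_ext _ (hom_ext' fun i x => ?_)
      induction x using QuotientGroup.induction_on with
      | H x => exact congrArg (fun f => Hom.f f.hom i x) hm

/-! ### The lattice on truncated crossed complexes -/

theorem muLE_zero (n : ℕ) : muLE.{u} n .zero = SubcatPair.zero _ :=
  SubcatPair.ext (funext fun M => propext (isZero_fullSubcategory_iff M).symm) rfl

theorem muLE_all (n : ℕ) : muLE.{u} n .all = SubcatPair.all _ :=
  SubcatPair.ext rfl (funext fun M => propext (isZero_fullSubcategory_iff M).symm)

/-- Degrees above `i` are already trivial, so nothing is left to be torsion and the criterion for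
the second class is vacuous. -/
theorem muLE_geSucc_of_le {n i : ℕ} (h : n ≤ i) :
    muLE.{u} n (.geSucc i) = SubcatPair.zero _ := by
  rw [← muLE_zero]
  refine SubcatPair.ext (funext fun M => propext ?_) (funext fun M => propext ?_)
  · change crsGE (i + 1) M.obj ↔ IsZero M.obj
    rw [isZero_iff]
    refine ⟨fun h1 j => ?_, fun h1 j _ => h1 j⟩
    rcases lt_or_ge j (i + 1) with hj | hj
    · exact h1 j hj
    · exact M.property j (by omega)
  · refine iff_of_true (fTr_iff.mpr ⟨fun x _ => ?_, fun j hj => ?_⟩) trivial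
    · exact (M.property (i + 1) (by omega)).elim _ _
    · exact M.property j (by omega)

/-- For a torsion object, degree `i` is the image of the trivial degree `i + 1`, so it vanishes
along with all others. -/
theorem muLE_le_of_le {n i : ℕ} (h : n ≤ i) : muLE.{u} n (.le i) = SubcatPair.zero _ := by
  rw [← muLE_zero]
  refine SubcatPair.ext (funext fun M => propext ?_) (funext fun M => propext ?_)
  · change kerCot i M.obj ↔ IsZero M.obj
    rw [isZero_iff, kerCot_iff]
    refine ⟨fun h1 j => ?_, fun h1 => ⟨fun j _ => h1 j, fun x => ⟨1, (h1 i).elim _ _⟩⟩⟩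
    rcases lt_trichotomy j i with hj | rfl | hj
    · exact h1.1 j hj
    · have := M.property (j + 1) (by omega)
      exact h1.2.subsingleton
    · exact M.property j (by omega)
  · exact iff_of_true (fun j hj => M.property j (by omega)) trivial

theorem muLE_isTorsionTheory (n : ℕ) (k : MuIndex) : (muLE.{u} n k).IsTorsionTheory := by
  have h : ∀ k : MuIndex, k ≠ .zero → (muLE.{u} n k).IsTorsionTheory := fun k hk => by
    refine ⟨⟨fun e => (mu k).T.prop_of_iso ((crsLE n).ι.mapIso e)⟩,
      ⟨fun e => (mu k).F.prop_of_iso ((crsLE n).ι.mapIso e)⟩, fun A B hA hB f => ?_, fun M => ?_⟩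
    · exact ObjectProperty.hom_ext _ (mu_hom_eq_zero k hA hB f.hom)
    · obtain ⟨S, hT, hF⟩ := exists_normalSub k hk M.obj
      obtain ⟨ε, η, w, h⟩ := exists_ses M S
      exact ⟨_, _, ε, η, w, hT, hF, h⟩
  by_cases hk : k = .zero
  -- The pair `0` equals `μ'_{≥ n+1}`, which the general argument covers.
  · rw [hk, muLE_zero, ← muLE_geSucc_of_le le_rfl]
    exact h _ (by simp)
  · exact h k hk

theorem range_muLE (n : ℕ) :
    Set.range (muLE.{u} n) = {SubcatPair.zero _, SubcatPair.all _} ∪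
        {p | ∃ i < n, p = muLE n (.geSucc i) ∨ p = muLE n (.le i)} := by
  ext p
  constructor
  · rintro ⟨k, rfl⟩
    cases k with
    | zero => exact Or.inl (Or.inl (muLE_zero n))
    | all => exact Or.inl (Or.inr (muLE_all n))
    | geSucc i =>
      rcases lt_or_ge i n with h | h
      · exact Or.inr ⟨i, h, Or.inl rfl⟩
      · exact Or.inl (Or.inl (muLE_geSucc_of_le h))
    | le i =>
      rcases lt_or_ge i n with h | h
      · exact Or.inr ⟨i, h, Or.inr rfl⟩
      · exact Or.inl (Or.inl (muLE_le_of_le h))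
  · rintro ((rfl | rfl) | ⟨i, _, rfl | rfl⟩)
    · exact ⟨_, muLE_zero n⟩
    · exact ⟨_, muLE_all n⟩
    · exact ⟨_, rfl⟩
    · exact ⟨_, rfl⟩

theorem zero_le_muLE (n : ℕ) (k : MuIndex) : SubcatPair.zero _ ≤ muLE.{u} n k := by
  intro M hM
  have h : ∀ i, Subsingleton (M.obj.X i) := isZero_iff.mp ((isZero_fullSubcategory_iff M).mp hM)
  cases k with
  | zero => exact isZero_iff.mpr h
  | all => trivial
  | geSucc i => exact fun j _ => h j
  | le i => exact kerCot_iff.mpr ⟨fun j _ => h j, fun x => ⟨1, (h i).elim _ _⟩⟩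

theorem muLE_geSucc_le_le (n i : ℕ) : muLE.{u} n (.geSucc i) ≤ muLE n (.le i) := fun M hM =>
  kerCot_iff.mpr ⟨fun j hj => hM j (by omega), fun x =>
    ⟨1, (hM i (Nat.lt_succ_self i)).elim _ _⟩⟩

theorem muLE_le_succ_le_geSucc (n i : ℕ) :
    muLE.{u} n (.le (i + 1)) ≤ muLE n (.geSucc i) := fun _ hM =>
  (kerCot_iff.mp hM).1

/-! ### Comparison with simplicial groups -/

section

variable {M : CrsGrp.{u}} {X : SimpGrp.{u}}

theorem subsingleton_iff_moore (φ : ∀ i, SimpGrp.moore X i ≃* M.X i) (i : ℕ) :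
    Subsingleton (M.X i) ↔ SimpGrp.moore X i = ⊥ := by
  rw [← (φ i).toEquiv.subsingleton_congr]
  exact ⟨fun _ => Subgroup.eq_bot_of_subsingleton _, fun h => by rw [h]; infer_instance⟩

theorem isZero_iff_of_moore (h : M.IsMooreComplexOf X) : IsZero M ↔ IsZero X := by
  obtain ⟨φ, _⟩ := h
  rw [isZero_iff, SimpGrp.isZero_iff]
  exact forall_congr' fun i => subsingleton_iff_moore φ i

theorem mu_T_iff_of_moore (h : M.IsMooreComplexOf X) (k : MuIndex) :
    (mu k).T M ↔ (SimpGrp.mu k).T X := by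
  cases k with
  | zero => exact isZero_iff_of_moore h
  | all => exact Iff.rfl
  | geSucc i =>
    obtain ⟨φ, _⟩ := h
    exact forall₂_congr fun j _ => subsingleton_iff_moore φ j
  | le i =>
    obtain ⟨φ, hφ⟩ := h
    refine kerCot_iff.trans (Iff.trans ?_ (SimpGrp.kerCot_iff i).symm)
    refine and_congr (forall₂_congr fun j _ => subsingleton_iff_moore φ j) ⟨fun h1 x hx => ?_,
      fun h1 x => ?_⟩
    · obtain ⟨y, hy⟩ := h1 (φ i ⟨x, hx⟩)
      obtain ⟨y, rfl⟩ := (φ (i + 1)).surjective y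
      rw [← hφ] at hy
      exact ⟨y.1, y.2, congrArg Subtype.val ((φ i).injective hy)⟩
    · obtain ⟨x, rfl⟩ := (φ i).surjective x
      obtain ⟨y, hy, hyx⟩ := h1 x.2
      exact ⟨φ (i + 1) ⟨y, hy⟩, by rw [← hφ]; exact congrArg (φ i) (Subtype.ext hyx)⟩

theorem mu_F_iff_of_moore (h : M.IsMooreComplexOf X) (k : MuIndex) :
    (mu k).F M ↔ (SimpGrp.mu k).F X := by
  cases k with
  | zero => exact Iff.rfl
  | all => exact isZero_iff_of_moore h
  | geSucc i =>
    obtain ⟨φ, hφ⟩ := h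
    refine fTr_iff.trans (Iff.trans ?_ (SimpGrp.fTr_iff i).symm)
    refine and_congr ⟨fun h1 x hx hd => ?_, fun h1 x hd => ?_⟩
      (forall₂_congr fun j _ => subsingleton_iff_moore φ j)
    · have h2 : SimpGrp.mooreD X i ⟨x, hx⟩ = 1 := Subtype.ext hd
      have h3 := h1 (φ (i + 1) ⟨x, hx⟩) (by rw [← hφ, h2, map_one])
      exact congrArg Subtype.val ((MulEquiv.map_eq_one_iff _).mp h3)
    · obtain ⟨x, rfl⟩ := (φ (i + 1)).surjective x
      rw [← hφ, MulEquiv.map_eq_one_iff] at hd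
      rw [MulEquiv.map_eq_one_iff]
      exact Subtype.ext (h1 x.1 x.2 (congrArg Subtype.val hd))
  | le i =>
    obtain ⟨φ, _⟩ := h
    exact forall₂_congr fun j _ => subsingleton_iff_moore φ j

end

/-! ### Crossed complexes concentrated in two degrees -/

/-- A commutative group as an object of `CommGrpCat`. -/
abbrev commGrp (G : Type u) [hG : Group G] (h : ∀ x y : G, x * y = y * x) : CommGrpCat.{u} :=
  letI : CommGroup G := { hG with mul_comm := h }
  CommGrpCat.of G

/-- A homomorphism of commutative groups as a morphism of `CommGrpCat`. -/
abbrev commGrpHom {G H : Type u} [hG : Group G] [hH : Group H] (hG' : ∀ x y : G, x * y = y * x)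
    (hH' : ∀ x y : H, x * y = y * x) (f : G →* H) : commGrp G hG' ⟶ commGrp H hH' :=
  letI : CommGroup G := { hG with mul_comm := hG' }
  letI : CommGroup H := { hH with mul_comm := hH' }
  CommGrpCat.ofHom f

/-- A chain complex of abelian groups as a crossed complex with trivial actions. -/
def ofAbelian (X : ℕ → CommGrpCat.{u}) (d : ∀ i, X (i + 1) →* X i)
    (d_d : ∀ i x, d i (d (i + 1) x) = 1) : CrsGrp.{u} where
  X i := X i
  d := d
  d_d := d_d
  act _ _ x := x
  act_zero g x := (mul_inv_cancel_comm g x).symm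
  one_act _ _ := rfl
  mul_act _ _ _ _ := rfl
  act_mul _ _ _ _ := rfl
  d_act _ _ _ := rfl
  peiffer x y := (mul_inv_cancel_comm x y).symm
  comm _ x y := mul_comm x y
  act_d _ _ _ := rfl

/-- `M` is trivial outside the degrees `m + 1` and `m + 2`. -/
def Concentrated (m : ℕ) (M : CrsGrp.{u}) : Prop :=
  ∀ i, i ≠ m + 1 → i ≠ m + 2 → Subsingleton (M.X i)

/-- Induction on `m` by prepending a trivial group. In the base case the two degrees are numerals,
so pattern matching places `A` and `B` without transport along equalities of indices. -/
theorem exists_chain {A B : CommGrpCat.{u}} (f : A →* B) (m : ℕ) :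
    ∃ (X : ℕ → CommGrpCat.{u}) (d : ∀ i, X (i + 1) →* X i), (∀ i x, d i (d (i + 1) x) = 1) ∧
      (∀ i, i ≠ m + 1 → i ≠ m + 2 → Subsingleton (X i)) ∧
      ∃ (eA : X (m + 2) ≃* A) (eB : X (m + 1) ≃* B), ∀ x, eB (d (m + 1) x) = f (eA x) := by
  induction m with
  | zero =>
    let X : ℕ → CommGrpCat.{u}
      | 1 => B
      | 2 => A
      | _ => CommGrpCat.of PUnit
    let d : ∀ i, X (i + 1) →* X i
      | 1 => f
      | 0 => 1
      | _ + 2 => 1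
    refine ⟨X, d, fun i x => ?_, fun i h1 h2 => ?_, MulEquiv.refl _, MulEquiv.refl _, fun _ => rfl⟩
    · match i, x with
      | 0, _ => rfl
      | 1, _ => exact map_one f
      | _ + 2, _ => rfl
    · match i, h1, h2 with
      | 0, _, _ => exact inferInstanceAs (Subsingleton PUnit)
      | i + 3, _, _ => exact inferInstanceAs (Subsingleton PUnit)
  | succ m ih =>
    obtain ⟨X, d, h1, h2, eA, eB, h3⟩ := ih
    let X' : ℕ → CommGrpCat.{u}
      | 0 => CommGrpCat.of PUnit
      | i + 1 => X i
    let d' : ∀ i, X' (i + 1) →* X' i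
      | 0 => 1
      | i + 1 => d i
    refine ⟨X', d', fun i x => ?_, fun i hi hi' => ?_, eA, eB, h3⟩
    · match i, x with
      | 0, _ => rfl
      | i + 1, x => exact h1 i x
    · match i, hi, hi' with
      | 0, _, _ => exact inferInstanceAs (Subsingleton PUnit)
      | i + 1, hi, hi' => exact h2 i (by omega) (by omega)

theorem exists_concentrated {A B : CommGrpCat.{u}} (f : A →* B) (m : ℕ) :
    ∃ M : CrsGrp.{u}, M.Concentrated m ∧
      ∃ (eA : M.X (m + 2) ≃* A) (eB : M.X (m + 1) ≃* B), ∀ x, eB (M.d (m + 1) x) = f (eA x) := by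
  obtain ⟨X, d, h1, h⟩ := exists_chain f m
  exact ⟨ofAbelian X d h1, h⟩

/-- Degree `m` is trivial, so every element of degree `m + 1` is a cycle. For `m = 0` commutativity
is then the Peiffer identity. -/
theorem Concentrated.comm {m : ℕ} {M : CrsGrp.{u}} (hM : M.Concentrated m) (x y : M.X (m + 1)) :
    x * y = y * x :=
  M.cycles_comm m x y ((hM m (by omega) (by omega)).elim _ _)

theorem Concentrated.hom_ext {m : ℕ} {M N : CrsGrp.{u}} (hM : M.Concentrated m) {f g : M ⟶ N}
    (h1 : ∀ x, Hom.f f (m + 1) x = Hom.f g (m + 1) x)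
    (h2 : ∀ x, Hom.f f (m + 2) x = Hom.f g (m + 2) x) : f = g := by
  refine hom_ext' fun i x => ?_
  by_cases hi : i = m + 1
  · subst hi; exact h1 x
  by_cases hi' : i = m + 2
  · subst hi'; exact h2 x
  rw [(hM i hi hi').elim x 1, map_one, map_one]

/-- Commutative squares give morphisms of concentrated crossed complexes. -/
theorem Concentrated.exists_hom {m : ℕ} {M N : CrsGrp.{u}} (hM : M.Concentrated m)
    (hN : N.Concentrated m) (b : M.X (m + 1) →* N.X (m + 1)) (a : M.X (m + 2) →* N.X (m + 2))
    (h : ∀ x, b (M.d (m + 1) x) = N.d (m + 1) (a x)) :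
    ∃ f : M ⟶ N, Hom.f f (m + 1) = b ∧ Hom.f f (m + 2) = a := by
  let F : ∀ i, M.X i →* N.X i := Function.update (Function.update (fun _ => 1) (m + 1) b) (m + 2) a
  have h1 : F (m + 1) = b := by
    simp only [F]
    rw [Function.update_of_ne (by omega), Function.update_self]
  have h2 : F (m + 2) = a := Function.update_self _ _ _
  have hM0 := hM 0 (by omega) (by omega)
  refine ⟨⟨F, fun i x => ?_, fun i g x => ?_⟩, h1, h2⟩
  · by_cases hi : i = m + 1
    · subst hi
      rw [h1, h2, h]
    -- Out of degree `m + 1` the square commutes because the target has trivial degree `m`; in the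
    -- remaining cases the source group is trivial.
    by_cases hi' : i = m
    · subst hi'
      exact (hN i (by omega) (by omega)).elim _ _
    · rw [(hM (i + 1) (by omega) (by omega)).elim x 1]
      simp only [map_one]
  -- Degree `0` is neither `m + 1` nor `m + 2`, so the acting group is trivial and equivariance is
  -- automatic.
  · rw [hM0.elim g 1, map_one, M.one_act, N.one_act]

/-! ### The torsion categories as categories of homomorphisms and of abelian groups. -/

theorem concentrated_of_le {m : ℕ} (M : (muLE.{u} (m + 2) (.le (m + 1))).T.FullSubcategory) :
    M.obj.obj.Concentrated m := fun i h1 h2 => by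
  rcases lt_or_ge i (m + 1) with hi | hi
  · exact (kerCot_iff.mp M.property).1 i hi
  · exact M.obj.property i (by omega)

theorem concentrated_of_geSucc {m : ℕ}
    (M : (muLE.{u} (m + 2) (.geSucc (m + 1))).T.FullSubcategory) :
    M.obj.obj.Concentrated m := fun i h1 h2 => by
  rcases lt_or_ge i (m + 2) with hi | hi
  · exact M.property i hi
  · exact M.obj.property i (by omega)

/-- The functor sending `M` to its differential `M_{m+2} → M_{m+1}`. -/
def diffFunctor (m : ℕ) :
    (muLE.{u} (m + 2) (.le (m + 1))).T.FullSubcategory ⥤ surjAb.{u}.FullSubcategory where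
  obj M :=
    { obj := Arrow.mk
        (commGrpHom (M.obj.obj.comm m) (concentrated_of_le M).comm (M.obj.obj.d (m + 1)))
      property := (kerCot_iff.mp M.property).2 }
  map {M N} f := ObjectProperty.homMk (Arrow.homMk
    (commGrpHom _ _ (Hom.f f.hom.hom (m + 2))) (commGrpHom _ _ (Hom.f f.hom.hom (m + 1))) (by
      ext x
      exact (Hom.comm_d f.hom.hom (m + 1) x).symm))

instance (m : ℕ) : (diffFunctor.{u} m).Faithful where
  map_injective {M N f g} h := by
    refine ObjectProperty.hom_ext _ (ObjectProperty.hom_ext _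
      ((concentrated_of_le M).hom_ext (fun x => ?_) fun x => ?_))
    · exact congrArg (fun φ => φ.hom.right.hom x) h
    · exact congrArg (fun φ => φ.hom.left.hom x) h

instance (m : ℕ) : (diffFunctor.{u} m).Full where
  map_surjective {M N} φ := by
    obtain ⟨f, h1, h2⟩ := (concentrated_of_le M).exists_hom (concentrated_of_le N)
      φ.hom.right.hom φ.hom.left.hom
      (fun x => congrArg (fun ψ => ψ.hom x) φ.hom.w.symm)
    refine ⟨ObjectProperty.homMk (ObjectProperty.homMk f), ?_⟩
    refine ObjectProperty.hom_ext _ (Arrow.hom_ext _ _ ?_ ?_)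
    · ext x
      exact DFunLike.congr_fun h2 x
    · ext x
      exact DFunLike.congr_fun h1 x

instance (m : ℕ) : (diffFunctor.{u} m).EssSurj where
  mem_essImage p := by
    obtain ⟨M, hM, eA, eB, h⟩ := exists_concentrated p.obj.hom.hom m
    refine ⟨⟨⟨M, fun i hi => hM i (by omega) (by omega)⟩,
      kerCot_iff.mpr ⟨fun i hi => hM i (by omega) (by omega), fun y => ?_⟩⟩, ⟨?_⟩⟩
    · obtain ⟨x, hx⟩ := p.property (eB y)
      exact ⟨eA.symm x, eB.injective ((h _).trans (by rw [eA.apply_symm_apply, hx]))⟩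
    · refine ObjectProperty.isoMk _ (Arrow.isoMk
        (MulEquiv.toCommGrpIso (X := commGrp (M.X (m + 2)) (M.comm m)) eA)
        (MulEquiv.toCommGrpIso (X := commGrp (M.X (m + 1)) hM.comm) eB) ?_)
      ext x
      exact (h x).symm

instance (m : ℕ) : (diffFunctor.{u} m).IsEquivalence where

/-- The functor sending `M` to `M_{m+2}`. -/
def topFunctor (m : ℕ) :
    (muLE.{u} (m + 2) (.geSucc (m + 1))).T.FullSubcategory ⥤ CommGrpCat.{u} where
  obj M := commGrp (M.obj.obj.X (m + 2)) (M.obj.obj.comm m)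
  map f := commGrpHom _ _ (Hom.f f.hom.hom (m + 2))

instance (m : ℕ) : (topFunctor.{u} m).Faithful where
  map_injective {M N f g} h := by
    refine ObjectProperty.hom_ext _ (ObjectProperty.hom_ext _
      ((concentrated_of_geSucc M).hom_ext (fun x => ?_) fun x => ?_))
    · exact (N.property (m + 1) (Nat.lt_succ_self _)).elim _ _
    · exact congrArg (fun φ => φ.hom x) h

instance (m : ℕ) : (topFunctor.{u} m).Full where
  map_surjective {M N} φ := by
    obtain ⟨f, -, h2⟩ := (concentrated_of_geSucc M).exists_hom (concentrated_of_geSucc N) 1 φ.hom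
      (fun x => (N.property (m + 1) (Nat.lt_succ_self _)).elim _ _)
    refine ⟨ObjectProperty.homMk (ObjectProperty.homMk f), ?_⟩
    ext x
    exact DFunLike.congr_fun h2 x

instance (m : ℕ) : (topFunctor.{u} m).EssSurj where
  mem_essImage A := by
    -- The one-element target leaves `m + 2` as the only degree that can be nontrivial.
    obtain ⟨M, hM, eA, eB, -⟩ := exists_concentrated (1 : A →* CommGrpCat.of PUnit.{u + 1}) m
    have h1 : Subsingleton (M.X (m + 1)) :=
      eB.toEquiv.subsingleton_congr.mpr (inferInstanceAs (Subsingleton PUnit))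
    refine ⟨⟨⟨M, fun i hi => hM i (by omega) (by omega)⟩, fun i hi => ?_⟩,
      ⟨MulEquiv.toCommGrpIso (X := commGrp (M.X (m + 2)) (M.comm m)) eA⟩⟩
    by_cases hi' : i = m + 1
    · subst hi'; exact h1
    · exact hM i hi' (by omega)

instance (m : ℕ) : (topFunctor.{u} m).IsEquivalence where

end CrsGrp

theorem mainTheorem11 (n : ℕ) (hn : 1 < n) :
    -- the lattice on `Crs(Grp)_{n ≥}` is the restriction of `μ(Grp)` along the Moore normalization
    (∀ (M : (CrsGrp.crsLE.{u} n).FullSubcategory) (X : SimpGrp.{u}), M.obj.IsMooreComplexOf X →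
      ∀ k : MuIndex, ((CrsGrp.muLE n k).T M ↔ (SimpGrp.mu k).T X) ∧
        ((CrsGrp.muLE n k).F M ↔ (SimpGrp.mu k).F X)) ∧
    -- its members are torsion theories
    (∀ k : MuIndex, (CrsGrp.muLE.{u} n k).IsTorsionTheory) ∧
    -- its members are `0`, `μ'_{≥ i+1}` and `μ'_{i ≥}` for `i < n`, and `Crs(Grp)_{n ≥}`
    (Set.range (CrsGrp.muLE.{u} n) =
      {SubcatPair.zero _, SubcatPair.all _} ∪
        {p | ∃ i < n, p = CrsGrp.muLE n (.geSucc i) ∨ p = CrsGrp.muLE n (.le i)}) ∧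
    -- they form the chain `0 ≤ μ'_{≥ n} ≤ μ'_{n-1 ≥} ≤ ⋯ ≤ μ'_{≥ 1} ≤ μ'_{0 ≥} ≤ Crs(Grp)_{n ≥}`
    (SubcatPair.zero _ ≤ CrsGrp.muLE.{u} n (.geSucc (n - 1)) ∧
      (∀ i < n, CrsGrp.muLE.{u} n (.geSucc i) ≤ CrsGrp.muLE n (.le i)) ∧
      (∀ i, i + 1 < n → CrsGrp.muLE.{u} n (.le (i + 1)) ≤ CrsGrp.muLE n (.geSucc i)) ∧
      CrsGrp.muLE.{u} n (.le 0) ≤ SubcatPair.all _) ∧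
    -- the torsion category `Ker (cot_{n-1}) ∩ Crs(Grp)_{n ≥}` of `μ'_{n-1 ≥}`
    Nonempty ((CrsGrp.muLE.{u} n (.le (n - 1))).T.FullSubcategory ≌ surjAb.{u}.FullSubcategory) ∧
    -- the torsion category `Crs(Grp)_{≥ n} ∩ Crs(Grp)_{n ≥}` of `μ'_{≥ n}`
    Nonempty ((CrsGrp.muLE.{u} n (.geSucc (n - 1))).T.FullSubcategory ≌ CommGrpCat.{u}) := by
  -- This is where `n > 1` enters: `n - 1 = m + 1` is a positive degree, which keeps degree `0` out
  -- of the torsion objects of (c) and (d).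
  obtain ⟨m, rfl⟩ : ∃ m, n = m + 2 := ⟨n - 2, by omega⟩
  exact ⟨fun M X h k => ⟨CrsGrp.mu_T_iff_of_moore h k, CrsGrp.mu_F_iff_of_moore h k⟩,
    CrsGrp.muLE_isTorsionTheory _, CrsGrp.range_muLE _,
    ⟨CrsGrp.zero_le_muLE _ _, fun i _ => CrsGrp.muLE_geSucc_le_le _ i,
      fun i _ => CrsGrp.muLE_le_succ_le_geSucc _ i, fun _ _ => trivial⟩,
    ⟨(CrsGrp.diffFunctor m).asEquivalence⟩, ⟨(CrsGrp.topFunctor m).asEquivalence⟩⟩
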